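/- Let $\mathfrak o$ be a Dedekind domain that is not a field, $K$ its field of fractions, $L/K$ a (possibly infinite) Galois extension with group $G=\mathrm{Gal}(L/K)$ (with the Krull topology), and $\mathfrak O$ the integral closure of $\mathfrak o$ in $L$. Let $\mathcal F(\mathfrak O)\supseteq\mathcal I(\mathfrak O)\supseteq\mathcal P(\mathfrak O)$ be the monoids of non-zero fractional, invertible fractional and principal fractional ideals of $\mathfrak O$, and put $\mathrm{Cl}(\mathfrak O)=\mathcal F(\mathfrak O)/\mathcal P(\mathfrak O)$, $\mathrm{Pic}(\mathfrak O)=\mathcal I(\mathfrak O)/\mathcal P(\mathfrak O)$. For a commutative monoid $M$ let $\mathrm{Reg}\,M=\{a\in M : a=aba \text{ for some } b\in M\}$. Let $\widetilde{\mathbb R}=\mathbb R\times\{0,1\}$ with the lexicographic order, the addition $(\alpha,s)+(\beta,t)=(\alpha+\beta,\max\{s,t\})$ and the involution $\iota(\alpha,s)=(-\alpha,s)$. For a topological space $X$ and a submonoid $M\subseteq\widetilde{\mathbb R}$, let $\mathcal S(X;M)$ be the monoid (under pointwise addition) of functions $f:X\to M$ that are upper semicontinuous ($\{x : f(x)<a\}$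 is open for every $a\in\widetilde{\mathbb R}$), bounded, and equal to $(0,0)$ outside some compact set, and let $\mathcal S_{\mathrm{ref}}(X;M)$ be the submonoid of those $f$ with $\iota\circ f\in\mathcal S(X;M)$ as well. For a maximal ideal $\mathfrak P$ of $\mathfrak O$ let $v_{\mathfrak P}:L^\times\to\mathbb Q$ be the additive valuation at $\mathfrak P$ normalized by $v_{\mathfrak P}(K^\times)=\mathbb Z$, let $V_{\mathfrak P}$ be the closure of $v_{\mathfrak P}(L^\times)$ in $\mathbb R$, let $\mathrm{val}_{\mathfrak P}=v_{\mathfrak P}(L^\times)\times\{0\}$, and let $\widetilde V_{\mathfrak P}=\mathrm{val}_{\mathfrak P}\cup(\mathbb R\times\{1\})$ if $V_{\mathfrak P}=\mathbb R$ and $\widetilde V_{\mathfrak P}=\mathrm{val}_{\mathfrak P}$ otherwise. For $I\in\mathcal F(\mathfrak O)$ put $f_I(\mathfrak P)=\inf\{v_{\mathfrak P}(x) : 0\ne x\in I\}$, and let $\tilde f_I(\mathfrak P)\in\widetilde{\mathbb R}$ be $(f_I(\mathfrak P),0)$ if this infimum is attained and $(f_I(\mathfrak P),1)$ otherwise. For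 each maximal ideal $\mathfrak p$ of $\mathfrak o$ fix a maximal ideal $\mathfrak p_L$ of $\mathfrak O$ above $\mathfrak p$, with decomposition group $D_{\mathfrak p}=\{\sigma\in G : \sigma(\mathfrak p_L)=\mathfrak p_L\}$, give $G/D_{\mathfrak p}$ the quotient topology, and put $$\mathcal M_{\mathfrak p}=\mathcal S(G/D_{\mathfrak p};\widetilde V_{\mathfrak p_L})/\mathcal S_{\mathrm{ref}}(G/D_{\mathfrak p};\mathrm{val}_{\mathfrak p_L}),\qquad \mathcal N_{\mathfrak p}=\mathcal S_{\mathrm{ref}}(G/D_{\mathfrak p};\widetilde V_{\mathfrak p_L})/\mathcal S_{\mathrm{ref}}(G/D_{\mathfrak p};\mathrm{val}_{\mathfrak p_L})\subseteq\mathcal M_{\mathfrak p}.$$ The group $G$ acts on fractional ideals by $I\mapsto\sigma(I)$, hence on $\mathrm{Cl}(\mathfrak O)/\mathrm{Pic}(\mathfrak O)$, and on functions on $G/D_{\mathfrak p}$ by $(\sigma f)(\tau D_{\mathfrak p})=f(\sigma^{-1}\tau D_{\mathfrak p})$, hence on $\mathcal M_{\mathfrak p}$. Then for every $I\in\mathcal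 F(\mathfrak O)$ and every $\mathfrak p$ the rule $\sigma D_{\mathfrak p}\mapsto\tilde f_I(\sigma(\mathfrak p_L))$ defines an element of $\mathcal S(G/D_{\mathfrak p};\widetilde V_{\mathfrak p_L})$, and sending the class of $I$ to the family of the classes of these functions is a well-defined $G$-equivariant isomorphism of commutative monoids $$\mathrm{Cl}(\mathfrak O)/\mathrm{Pic}(\mathfrak O)\;\xrightarrow{\ \sim\ }\;\bigoplus_{\mathfrak p}\mathcal M_{\mathfrak p},$$ where $\mathfrak p$ runs over the maximal ideals of $\mathfrak o$. The image of $\mathrm{Reg}\,\mathrm{Cl}(\mathfrak O)/\mathrm{Pic}(\mathfrak O)$ under it is $\bigoplus_{\mathfrak p}\mathcal N_{\mathfrak p}$, and this equals $\bigoplus_{\mathfrak p\in R^\infty}\mathcal N_{\mathfrak p}$, where $R^\infty$ is the set of those $\mathfrak p$ for which $v_{\mathfrak p_L}(L^\times)\ne V_{\mathfrak p_L}$, i.e. for which $v_{\mathfrak p_L}(L^\times)$ is not discrete in $\mathbb R$. -/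

import Mathlib

open scoped nonZeroDivisors Pointwise DirectSum

namespace IdealClassMonoid

noncomputable section

/-! ### Quotients of commutative monoids and regular elements -/

section Quotients

/-- The congruence on a commutative monoid `M` defined by a submonoid `N`: `a` and `b` are
identified when `a * x = b * y` for some `x, y ∈ N`. If `N` is a group, the classes are the
orbits of `N`. -/
@[to_additive /-- The congruence on a commutative additive monoid `M` defined by a submonoid `N`:
`a` and `b` are identified when `a + x = b + y` for some `x, y ∈ N`. If `N` is a group, the classes
are the orbits of `N`. -/]
def mulQuotCon {M : Type*} [CommMonoid M] (N : Submonoid M) : Con M where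
  r a b := ∃ x ∈ N, ∃ y ∈ N, a * x = b * y
  iseqv :=
    { refl := fun _ => ⟨1, N.one_mem, 1, N.one_mem, rfl⟩
      symm := fun ⟨x, hx, y, hy, h⟩ => ⟨y, hy, x, hx, h.symm⟩
      trans := by
        rintro a b c ⟨x, hx, y, hy, h⟩ ⟨x', hx', y', hy', h'⟩
        refine ⟨x * x', N.mul_mem hx hx', y' * y, N.mul_mem hy' hy, ?_⟩
        rw [← mul_assoc, h, mul_right_comm, h', mul_assoc] }
  mul' := by
    rintro a b c d ⟨x, hx, y, hy, h⟩ ⟨x', hx', y', hy', h'⟩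
    refine ⟨x * x', N.mul_mem hx hx', y * y', N.mul_mem hy hy', ?_⟩
    rw [mul_mul_mul_comm, h, h', mul_mul_mul_comm]

/-- The quotient monoid `M / N`. -/
abbrev MulQuot {M : Type*} [CommMonoid M] (N : Submonoid M) : Type _ := (mulQuotCon N).Quotient

/-- The quotient monoid `M / N`, written additively. -/
abbrev AddQuot {M : Type*} [AddCommMonoid M] (N : AddSubmonoid M) : Type _ :=
  (addQuotCon N).Quotient

/-- The projection `M → M / N`. -/
abbrev MulQuot.mk {M : Type*} [CommMonoid M] (N : Submonoid M) : M →* MulQuot N :=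
  (mulQuotCon N).mk'

/-- The projection `M → M / N`, written additively. -/
abbrev AddQuot.mk {M : Type*} [AddCommMonoid M] (N : AddSubmonoid M) : M →+ AddQuot N :=
  (addQuotCon N).mk'

/-- An action of a group `G` on `M` by automorphisms that preserve `N` induces an action on
`M / N`, by `g • [a] = [g • a]`. -/
@[reducible]
def mulQuotAction {M : Type*} [CommMonoid M] (N : Submonoid M) (G : Type*) [Group G]
    [MulDistribMulAction G M] (hN : ∀ g : G, ∀ x ∈ N, g • x ∈ N) :
    MulDistribMulAction G (MulQuot N) where
  smul g := (mulQuotCon N).lift ((mulQuotCon N).mk'.comp (MulDistribMulAction.toMonoidHom M g)) (by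
    rintro a b ⟨x, hx, y, hy, h⟩
    refine (Con.eq (mulQuotCon N)).2 ⟨g • x, hN g x hx, g • y, hN g y hy, ?_⟩
    simp only [MulDistribMulAction.toMonoidHom_apply, ← smul_mul', h])
  one_smul a := by
    induction a using Con.induction_on with
    | H a => exact congrArg (MulQuot.mk N) (one_smul G a)
  mul_smul g h a := by
    induction a using Con.induction_on with
    | H a => exact congrArg (MulQuot.mk N) (mul_smul g h a)
  smul_one _ := map_one _
  smul_mul _ _ _ := map_mul _ _ _

/-- An action of a group `G` on `M` by automorphisms that preserve `N` induces an action on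
`M / N`, by `g • [a] = [g • a]` (additive version). -/
@[reducible]
def addQuotAction {M : Type*} [AddCommMonoid M] (N : AddSubmonoid M) (G : Type*) [Group G]
    [DistribMulAction G M] (hN : ∀ g : G, ∀ x ∈ N, g • x ∈ N) :
    DistribMulAction G (AddQuot N) where
  smul g := (addQuotCon N).lift ((addQuotCon N).mk'.comp (DistribSMul.toAddMonoidHom M g)) (by
    rintro a b ⟨x, hx, y, hy, h⟩
    refine (AddCon.eq (addQuotCon N)).2 ⟨g • x, hN g x hx, g • y, hN g y hy, ?_⟩
    simp only [DistribSMul.toAddMonoidHom_apply, ← smul_add, h])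
  one_smul a := by
    induction a using AddCon.induction_on with
    | H a => exact congrArg (AddQuot.mk N) (one_smul G a)
  mul_smul g h a := by
    induction a using AddCon.induction_on with
    | H a => exact congrArg (AddQuot.mk N) (mul_smul g h a)
  smul_zero _ := map_zero _
  smul_add _ _ _ := map_add _ _ _

/-- `Reg M`: the von Neumann regular elements of a monoid. -/
def Reg (M : Type*) [Monoid M] : Set M := {a | ∃ b : M, a = a * b * a}

end Quotients

/-! ### The monoid `ℝ × {0, 1}` -/

/-- The set `ℝ × {0, 1}`; the second component is a Boolean, with `false` for `0` and `true`
for `1`. -/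
@[ext]
structure RTilde where
  /-- The real component. -/
  fst : ℝ
  /-- The component in `{0, 1}`. -/
  snd : Bool

namespace RTilde

/-- `(α, s) + (β, t) = (α + β, max s t)`. -/
instance : Add RTilde := ⟨fun a b => ⟨a.fst + b.fst, max a.snd b.snd⟩⟩

instance : Zero RTilde := ⟨⟨0, false⟩⟩

@[simp] theorem add_fst (a b : RTilde) : (a + b).fst = a.fst + b.fst := rfl
@[simp] theorem add_snd (a b : RTilde) : (a + b).snd = max a.snd b.snd := rfl
@[simp] theorem zero_fst : (0 : RTilde).fst = 0 := rfl
@[simp] theorem zero_snd : (0 : RTilde).snd = false := rfl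

instance : AddCommMonoid RTilde where
  add_assoc a b c := RTilde.ext (add_assoc _ _ _) (max_assoc _ _ _)
  zero_add a := RTilde.ext (zero_add _) (by simp)
  add_zero a := RTilde.ext (add_zero _) (by simp)
  add_comm a b := RTilde.ext (add_comm _ _) (max_comm _ _)
  nsmul := nsmulRec

/-- The lexicographic order. -/
instance : LinearOrder RTilde :=
  LinearOrder.lift' (fun a => toLex (a.fst, a.snd)) (fun a b h => by
    have h' : (a.fst, a.snd) = (b.fst, b.snd) := toLex_inj.1 h
    exact RTilde.ext (congrArg Prod.fst h') (congrArg Prod.snd h'))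

theorem lt_iff (a b : RTilde) : a < b ↔ a.fst < b.fst ∨ a.fst = b.fst ∧ a.snd < b.snd :=
  Prod.Lex.toLex_lt_toLex

theorem le_iff (a b : RTilde) : a ≤ b ↔ a.fst < b.fst ∨ a.fst = b.fst ∧ a.snd ≤ b.snd :=
  Prod.Lex.toLex_le_toLex

theorem add_le_add' {a b c d : RTilde} (h : a ≤ b) (h' : c ≤ d) : a + c ≤ b + d := by
  rw [le_iff] at *
  simp only [add_fst, add_snd]
  rcases h with h | ⟨h, hs⟩ <;> rcases h' with h' | ⟨h', hs'⟩
  · left; linarith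
  · left; linarith
  · left; linarith
  · right; exact ⟨by rw [h, h'], max_le_max hs hs'⟩

/-- The involution `ι (α, s) = (-α, s)`. -/
def iota (a : RTilde) : RTilde := ⟨-a.fst, a.snd⟩

theorem iota_zero : iota 0 = 0 := RTilde.ext neg_zero rfl

theorem iota_add (a b : RTilde) : iota (a + b) = iota a + iota b :=
  RTilde.ext (neg_add _ _) rfl

end RTilde

/-! ### Upper semicontinuous functions with values in `ℝ × {0, 1}` -/

section Functions

variable {X : Type*} [TopologicalSpace X]

theorem upperSemicontinuous_add {f g : X → RTilde} (hf : UpperSemicontinuous f)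
    (hg : UpperSemicontinuous g) : UpperSemicontinuous (f + g) := by
  intro x c hc
  have key : ∃ a b : RTilde, f x < a ∧ g x < b ∧ ∀ u < a, ∀ v < b, u + v < c := by
    simp only [Pi.add_apply, RTilde.lt_iff, RTilde.add_fst, RTilde.add_snd] at hc
    rcases hc with hc | ⟨hc, hs⟩
    · set ε := (c.fst - ((f x).fst + (g x).fst)) / 2 with hε
      have hpos : 0 < ε := by rw [hε]; linarith
      refine ⟨⟨(f x).fst + ε, false⟩, ⟨(g x).fst + ε, false⟩, ?_, ?_, ?_⟩
      · rw [RTilde.lt_iff]; left; simpa using hpos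
      · rw [RTilde.lt_iff]; left; simpa using hpos
      · intro u hu v hv
        rw [RTilde.lt_iff] at *
        have hb : ∀ s : Bool, ¬ s < false := by decide
        simp only [hb, and_false, or_false] at hu hv
        left
        simp only [RTilde.add_fst]
        linarith
    · refine ⟨⟨(f x).fst, true⟩, ⟨(g x).fst, true⟩, ?_, ?_, ?_⟩
      · rw [RTilde.lt_iff]; right
        refine ⟨rfl, ?_⟩
        change _ < true
        revert hs
        generalize (f x).snd = s, (g x).snd = t, c.snd = u
        revert s t u
        decide
      · rw [RTilde.lt_iff]; right
        refine ⟨rfl, ?_⟩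
        change _ < true
        revert hs
        generalize (f x).snd = s, (g x).snd = t, c.snd = u
        revert s t u
        decide
      · have hcs : c.snd = true := by
          revert hs
          generalize (f x).snd = s, (g x).snd = t, c.snd = u
          revert s t u
          decide
        intro u hu v hv
        rw [RTilde.lt_iff] at *
        simp only [RTilde.add_fst, RTilde.add_snd, hcs] at *
        rcases hu with hu | ⟨hu, hus⟩ <;> rcases hv with hv | ⟨hv, hvs⟩
        · left; linarith
        · left; linarith
        · left; linarith
        · right; exact ⟨by rw [hu, hv, hc], max_lt hus hvs⟩
  obtain ⟨a, b, ha, hb, h⟩ := key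
  filter_upwards [hf x a ha, hg x b hb] with y hya hyb
  exact h _ hya _ hyb

/-- `S(X; M)`: the bounded, compactly supported, upper semicontinuous functions on `X` with values
in the submonoid `M` of `ℝ × {0, 1}`. -/
def Sb (X : Type*) [TopologicalSpace X] (M : AddSubmonoid RTilde) :
    AddSubmonoid (X → RTilde) where
  carrier := {f | UpperSemicontinuous f ∧ (∃ Y : Set X, IsCompact Y ∧ ∀ x ∉ Y, f x = 0) ∧
    BddAbove (Set.range f) ∧ BddBelow (Set.range f) ∧ ∀ x, f x ∈ M}
  zero_mem' := by
    refine ⟨upperSemicontinuous_const, ⟨∅, isCompact_empty, fun _ _ => rfl⟩, ⟨0, ?_⟩, ⟨0, ?_⟩,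
      fun _ => M.zero_mem⟩
    · rintro _ ⟨x, rfl⟩; exact le_rfl
    · rintro _ ⟨x, rfl⟩; exact le_rfl
  add_mem' := by
    rintro f g ⟨hf, ⟨Y, hY, hfY⟩, ⟨a, ha⟩, ⟨b, hb⟩, hfM⟩ ⟨hg, ⟨Z, hZ, hgZ⟩, ⟨c, hc⟩, ⟨d, hd⟩, hgM⟩
    refine ⟨upperSemicontinuous_add hf hg, ⟨Y ∪ Z, hY.union hZ, fun x hx => ?_⟩, ⟨a + c, ?_⟩,
      ⟨b + d, ?_⟩, fun x => M.add_mem (hfM x) (hgM x)⟩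
    · rw [Set.mem_union, not_or] at hx
      rw [Pi.add_apply, hfY x hx.1, hgZ x hx.2, add_zero]
    · rintro _ ⟨x, rfl⟩; exact RTilde.add_le_add' (ha ⟨x, rfl⟩) (hc ⟨x, rfl⟩)
    · rintro _ ⟨x, rfl⟩; exact RTilde.add_le_add' (hb ⟨x, rfl⟩) (hd ⟨x, rfl⟩)

/-- The reflexible functions in `S(X; M)`: those `f` for which `ι ∘ f` lies in `S(X; M)` as
well. -/
def Sref (X : Type*) [TopologicalSpace X] (M : AddSubmonoid RTilde) :
    AddSubmonoid (X → RTilde) where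
  carrier := {f | f ∈ Sb X M ∧ RTilde.iota ∘ f ∈ Sb X M}
  zero_mem' := by
    refine ⟨(Sb X M).zero_mem, ?_⟩
    have h : RTilde.iota ∘ (0 : X → RTilde) = 0 := funext fun _ => RTilde.iota_zero
    rw [h]; exact (Sb X M).zero_mem
  add_mem' := by
    rintro f g ⟨hf, hf'⟩ ⟨hg, hg'⟩
    refine ⟨(Sb X M).add_mem hf hg, ?_⟩
    have h : RTilde.iota ∘ (f + g) = RTilde.iota ∘ f + RTilde.iota ∘ g :=
      funext fun _ => RTilde.iota_add _ _
    rw [h]; exact (Sb X M).add_mem hf' hg'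

/-- `Sref(X; W)` as a submonoid of `S(X; V)`, for submonoids `W ⊆ V` of `ℝ × {0, 1}`. -/
def SrefIn (X : Type*) [TopologicalSpace X] (V W : AddSubmonoid RTilde) : AddSubmonoid (Sb X V) :=
  (Sref X W).comap (Sb X V).subtype

/-- The quotient monoid `S(X; V) / Sref(X; W)`. -/
abbrev QuotM (X : Type*) [TopologicalSpace X] (V W : AddSubmonoid RTilde) : Type _ :=
  AddQuot (SrefIn X V W)

/-- The quotient monoid `Sref(X; V) / Sref(X; W)`, as a submonoid of `S(X; V) / Sref(X; W)`: both
quotients are taken by the same relation, so this is the image of `Sref(X; V)`. -/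
def QuotN (X : Type*) [TopologicalSpace X] (V W : AddSubmonoid RTilde) :
    AddSubmonoid (QuotM X V W) :=
  (SrefIn X V V).map (AddQuot.mk (SrefIn X V W))

variable {G : Type*} [Group G] [MulAction G X] [ContinuousConstSMul G X]

theorem comp_mem_Sb {M : AddSubmonoid RTilde} (g : G) {f : X → RTilde} (hf : f ∈ Sb X M) :
    (fun x => f (g⁻¹ • x)) ∈ Sb X M := by
  obtain ⟨hf, ⟨Y, hY, hfY⟩, ⟨a, ha⟩, ⟨b, hb⟩, hfM⟩ := hf
  refine ⟨hf.comp (continuous_const_smul g⁻¹), ⟨g • Y, hY.smul g, fun x hx => hfY _ fun h => hx ?_⟩,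
    ⟨a, ?_⟩, ⟨b, ?_⟩, fun x => hfM _⟩
  · exact Set.mem_smul_set_iff_inv_smul_mem.2 h
  · rintro _ ⟨x, rfl⟩; exact ha ⟨_, rfl⟩
  · rintro _ ⟨x, rfl⟩; exact hb ⟨_, rfl⟩

/-- The left action of `G` on functions: `(g • f) x = f (g⁻¹ • x)`. -/
instance {M : AddSubmonoid RTilde} : DistribMulAction G (Sb X M) where
  smul g f := ⟨fun x => f.1 (g⁻¹ • x), comp_mem_Sb g f.2⟩
  one_smul f := Subtype.ext (funext fun x => by
    change f.1 ((1 : G)⁻¹ • x) = f.1 x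
    rw [inv_one, one_smul])
  mul_smul g h f := Subtype.ext (funext fun x => by
    change f.1 ((g * h)⁻¹ • x) = f.1 (h⁻¹ • g⁻¹ • x)
    rw [mul_inv_rev, mul_smul])
  smul_zero _ := rfl
  smul_add _ _ _ := rfl

/-- The induced action on `S(X; V) / Sref(X; W)`. -/
instance (V W : AddSubmonoid RTilde) : DistribMulAction G (QuotM X V W) :=
  addQuotAction (SrefIn X V W) G (fun g _ hf => ⟨comp_mem_Sb g hf.1, comp_mem_Sb g hf.2⟩)

end Functions

/-! ### Fractional ideals and classes -/

section Ideals

variable (R L : Type*) [CommRing R] [IsDomain R] [Field L] [Algebra R L]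

/-- `F(R)`: the monoid of non-zero fractional ideals of `R` in its field of fractions `L`. -/
def Frac : Submonoid (FractionalIdeal R⁰ L) where
  carrier := {I | I ≠ 0}
  one_mem' := one_ne_zero
  mul_mem' := by
    intro I J hI hJ h
    simp only [Set.mem_ofPred_eq, ne_eq, FractionalIdeal.eq_zero_iff, not_forall] at hI hJ
    obtain ⟨x, hx, hx0⟩ := hI
    obtain ⟨y, hy, hy0⟩ := hJ
    exact mul_ne_zero hx0 hy0 (FractionalIdeal.eq_zero_iff.1 h _ (FractionalIdeal.mul_mem_mul hx hy))

/-- `P(R)`: the principal fractional ideals `a R`, `a ∈ Lˣ`. -/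
def Princ : Submonoid (Frac R L) where
  carrier := {I | ∃ a : Lˣ, (I.1 : Submodule R L) = Submodule.span R {(a : L)}}
  one_mem' := ⟨1, by
    change ((1 : FractionalIdeal R⁰ L) : Submodule R L) = _
    rw [FractionalIdeal.coe_one, Units.val_one, Submodule.one_eq_span]⟩
  mul_mem' := by
    rintro I J ⟨a, ha⟩ ⟨b, hb⟩
    refine ⟨a * b, ?_⟩
    change ((I.1 * J.1 : FractionalIdeal R⁰ L) : Submodule R L) = _
    rw [FractionalIdeal.coe_mul, ha, hb, Submodule.span_mul_span, Set.singleton_mul_singleton,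
      Units.val_mul]

/-- The invertible fractional ideals: those `I` with `I J = R` for some fractional ideal `J`. -/
def InvFrac : Submonoid (Frac R L) := IsUnit.submonoid (Frac R L)

/-- The ideal class semigroup `Cl(R) = F(R) / P(R)`. -/
abbrev Cl : Type _ := MulQuot (Princ R L)

/-- The Picard group (the invertible ideals modulo the principal ones), as the submonoid of `Cl(R)`
of the classes of invertible ideals. -/
def PicIn : Submonoid (Cl R L) := (InvFrac R L).map (MulQuot.mk (Princ R L))

/-- The quotient monoid `Cl(R) / Pic(R)`. -/
abbrev ClModPic : Type _ := MulQuot (PicIn R L)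

end Ideals

/-! ### The Galois action on fractional ideals of the integral closure -/

section Galois

variable (o : Type*) {K : Type*} (L : Type*) [CommRing o] [Field K] [Field L]
  [Algebra o K] [Algebra K L] [Algebra o L] [IsScalarTower o K L]

/-- The integral closure of `o` in `L`. -/
abbrev IntCl : Type _ := integralClosure o L

variable {o L}

/-- `σ(I) = {σ(x) | x ∈ I}`. -/
def galIdeal (σ : Gal(L/K)) (I : FractionalIdeal (IntCl o L)⁰ L) :
    FractionalIdeal (IntCl o L)⁰ L :=
  ⟨{ carrier := σ '' {x | x ∈ I}
     add_mem' := by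
      rintro _ _ ⟨x, hx, rfl⟩ ⟨y, hy, rfl⟩
      exact ⟨x + y, I.1.add_mem hx hy, map_add σ x y⟩
     zero_mem' := ⟨0, I.1.zero_mem, map_zero σ⟩
     smul_mem' := by
      rintro a _ ⟨x, hx, rfl⟩
      refine ⟨(σ⁻¹ • a) • x, I.1.smul_mem _ hx, ?_⟩
      have h : ((σ⁻¹ • a : IntCl o L) : L) = σ⁻¹ (a : L) := rfl
      rw [Subalgebra.smul_def, Subalgebra.smul_def, smul_eq_mul, smul_eq_mul, map_mul, h]
      congr 1
      exact AlgEquiv.apply_symm_apply σ _ }, by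
    obtain ⟨d, hd, hI⟩ := I.isFractional
    refine ⟨σ • d, ?_, ?_⟩
    · rw [mem_nonZeroDivisors_iff_ne_zero] at hd ⊢
      exact (smul_ne_zero_iff_ne σ).2 hd
    · rintro _ ⟨x, hx, rfl⟩
      obtain ⟨c, hc⟩ := hI x hx
      refine ⟨σ • c, ?_⟩
      have h : ((σ • c : IntCl o L) : L) = σ (c : L) := rfl
      have h' : ((σ • d : IntCl o L) : L) = σ (d : L) := rfl
      have hc' : (c : L) = (d : L) * x := hc
      change ((σ • c : IntCl o L) : L) = ((σ • d : IntCl o L) : L) * σ x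
      rw [h, h', hc', map_mul]⟩

theorem mem_galIdeal {σ : Gal(L/K)} {I : FractionalIdeal (IntCl o L)⁰ L} {x : L} :
    x ∈ galIdeal σ I ↔ ∃ y ∈ I, σ y = x := Iff.rfl

theorem galIdeal_mul (σ : Gal(L/K)) (I J : FractionalIdeal (IntCl o L)⁰ L) :
    galIdeal σ (I * J) = galIdeal σ I * galIdeal σ J := by
  apply le_antisymm
  · rintro _ ⟨x, hx, rfl⟩
    refine FractionalIdeal.mul_induction_on (C := fun x => σ x ∈ galIdeal σ I * galIdeal σ J)
      hx ?_ ?_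
    · intro i hi j hj
      rw [map_mul]
      exact FractionalIdeal.mul_mem_mul ⟨i, hi, rfl⟩ ⟨j, hj, rfl⟩
    · intro x y hx hy
      rw [map_add]
      exact (galIdeal σ I * galIdeal σ J).1.add_mem hx hy
  · rw [FractionalIdeal.mul_le]
    rintro _ ⟨i, hi, rfl⟩ _ ⟨j, hj, rfl⟩
    exact ⟨i * j, FractionalIdeal.mul_mem_mul hi hj, map_mul σ i j⟩

theorem galIdeal_span (σ : Gal(L/K)) {I : FractionalIdeal (IntCl o L)⁰ L} {a : L}
    (hI : (I : Submodule (IntCl o L) L) = Submodule.span (IntCl o L) {a}) :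
    (galIdeal σ I : Submodule (IntCl o L) L) = Submodule.span (IntCl o L) {σ a} := by
  ext x
  rw [FractionalIdeal.mem_coe, mem_galIdeal, Submodule.mem_span_singleton]
  constructor
  · rintro ⟨y, hy, rfl⟩
    rw [← FractionalIdeal.mem_coe, hI, Submodule.mem_span_singleton] at hy
    obtain ⟨z, rfl⟩ := hy
    exact ⟨σ • z, (map_mul σ (z : L) a).symm⟩
  · rintro ⟨z, rfl⟩
    refine ⟨(σ⁻¹ • z) • a, ?_, ?_⟩
    · rw [← FractionalIdeal.mem_coe, hI]
      exact Submodule.smul_mem _ _ (Submodule.mem_span_singleton_self a)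
    · change σ (((σ⁻¹ • z : IntCl o L) : L) * a) = (z : L) * σ a
      rw [map_mul]
      congr 1
      exact AlgEquiv.apply_symm_apply σ _

theorem galIdeal_one (σ : Gal(L/K)) : galIdeal σ (1 : FractionalIdeal (IntCl o L)⁰ L) = 1 := by
  apply FractionalIdeal.coeToSubmodule_injective
  have h : ((1 : FractionalIdeal (IntCl o L)⁰ L) : Submodule (IntCl o L) L) =
      Submodule.span (IntCl o L) {(1 : L)} := by
    rw [FractionalIdeal.coe_one, Submodule.one_eq_span]
  change ((galIdeal σ 1 : FractionalIdeal (IntCl o L)⁰ L) : Submodule (IntCl o L) L) = _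
  rw [galIdeal_span σ h, map_one, ← h]

theorem galIdeal_ne_zero (σ : Gal(L/K)) {I : FractionalIdeal (IntCl o L)⁰ L} (hI : I ≠ 0) :
    galIdeal σ I ≠ 0 := by
  simp only [ne_eq, FractionalIdeal.eq_zero_iff, not_forall] at hI ⊢
  obtain ⟨x, hx, hx0⟩ := hI
  exact ⟨σ x, ⟨x, hx, rfl⟩, (map_ne_zero σ).2 hx0⟩

/-- The left action of `Gal(L/K)` on the monoid of fractional ideals. -/
instance : MulDistribMulAction Gal(L/K) (Frac (IntCl o L) L) where
  smul σ I := ⟨galIdeal σ I.1, galIdeal_ne_zero σ I.2⟩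
  one_smul _ := Subtype.ext (SetLike.coe_injective (Set.image_id _))
  mul_smul σ τ _ := Subtype.ext (SetLike.coe_injective (Set.image_comp σ τ _))
  smul_one σ := Subtype.ext (galIdeal_one σ)
  smul_mul σ I J := Subtype.ext (galIdeal_mul σ I.1 J.1)

instance : SMul Gal(L/K) (Frac (IntCl o L) L) := MulDistribMulAction.toMulAction.toSMul

/-- The induced action on the ideal class semigroup. -/
instance : MulDistribMulAction Gal(L/K) (Cl (IntCl o L) L) :=
  mulQuotAction (Princ (IntCl o L) L) Gal(L/K) (by
    rintro σ I ⟨a, ha⟩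
    refine ⟨Units.map (σ : L →* L) a, ?_⟩
    exact galIdeal_span σ ha)

instance : SMul Gal(L/K) (Cl (IntCl o L) L) := MulDistribMulAction.toMulAction.toSMul

/-- The induced action on the quotient of the ideal class semigroup by the Picard group. -/
instance : MulDistribMulAction Gal(L/K) (ClModPic (IntCl o L) L) :=
  mulQuotAction (PicIn (IntCl o L) L) Gal(L/K) (by
    rintro σ _ ⟨I, hI, rfl⟩
    obtain ⟨J, hJ⟩ := isUnit_iff_exists_inv.1 hI
    exact ⟨σ • I, isUnit_iff_exists_inv.2 ⟨σ • J, by rw [← smul_mul', hJ, smul_one]⟩, rfl⟩)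

instance : SMul Gal(L/K) (ClModPic (IntCl o L) L) := MulDistribMulAction.toMulAction.toSMul

/-- The action of `Gal(L/K)` on the maximal ideals of the integral closure. -/
instance : MulAction Gal(L/K) (MaximalSpectrum (IntCl o L)) where
  smul σ P := ⟨σ • P.asIdeal, by
    have := P.isMaximal
    exact Ideal.map_isMaximal_of_equiv (MulSemiringAction.toRingEquiv Gal(L/K) (IntCl o L) σ)⟩
  one_smul P := MaximalSpectrum.ext (one_smul _ P.asIdeal)
  mul_smul σ τ P := MaximalSpectrum.ext (mul_smul σ τ P.asIdeal)

variable (K) in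
/-- The decomposition group of a maximal ideal `P`. -/
def Decomp (P : MaximalSpectrum (IntCl o L)) : Subgroup Gal(L/K) :=
  MulAction.stabilizer Gal(L/K) P

end Galois

/-! ### The normalized valuations -/

section Valuation

theorem faithful_tower (o K L : Type*) [CommRing o] [Field K] [Field L] [Algebra o K]
    [IsFractionRing o K] [Algebra K L] [Algebra o L] [IsScalarTower o K L] : FaithfulSMul o L := by
  rw [faithfulSMul_iff_algebraMap_injective, IsScalarTower.algebraMap_eq o K L]
  exact (algebraMap K L).injective.comp (IsFractionRing.injective o K)

theorem intCl_ne_bot {o L : Type*} [CommRing o] [IsDomain o] [Fact (¬ IsField o)] [Field L]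
    [Algebra o L] [FaithfulSMul o L] (P : MaximalSpectrum (IntCl o L)) : P.asIdeal ≠ ⊥ := by
  refine Ring.ne_bot_of_isMaximal_of_not_isField P.isMaximal fun h => ?_
  exact (Fact.out : ¬ IsField o)
    (isField_of_isIntegral_of_isField (FaithfulSMul.algebraMap_injective o (IntCl o L)) h)

theorem log_valuation_div {o A B M N : Type*} [CommRing o] [IsDomain o] [CommRing A] [IsDedekindDomain A] [CommRing B]
    [IsDedekindDomain B] [Field M] [Field N] [Algebra A M] [IsFractionRing A M] [Algebra B N]
    [IsFractionRing B N] [Algebra o A] [Algebra o B] [FaithfulSMul o A]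
    [Algebra A B] [FaithfulSMul A B] [IsScalarTower o A B] [Algebra M N] [Algebra A N]
    [IsScalarTower A M N] [IsScalarTower A B N]
    (v : IsDedekindDomain.HeightOneSpectrum A) (w : IsDedekindDomain.HeightOneSpectrum B)
    (hw : v.asIdeal = w.asIdeal.under A) (x : M) :
    (-((WithZero.log (v.valuation M x) : ℤ) : ℚ)) /
        (Ideal.ramificationIdx' (v.asIdeal.under o) v.asIdeal : ℚ) =
      (-((WithZero.log (w.valuation N (algebraMap M N x)) : ℤ) : ℚ)) /
        (Ideal.ramificationIdx' (w.asIdeal.under o) w.asIdeal : ℚ) := by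
  have : w.asIdeal.LiesOver v.asIdeal := ⟨hw⟩
  have : v.asIdeal.LiesOver (v.asIdeal.under o) := ⟨rfl⟩
  have hunder : w.asIdeal.under o = v.asIdeal.under o := by rw [hw, Ideal.under_under]
  have hv := IsDedekindDomain.HeightOneSpectrum.valuation_liesOver N v w x
  have hr := Ideal.ramificationIdx'_algebra_tower' (v.asIdeal.under o) v.asIdeal w.asIdeal
  have he : (Ideal.ramificationIdx' v.asIdeal w.asIdeal : ℚ) ≠ 0 :=
    Nat.cast_ne_zero.2 (Ideal.IsDedekindDomain.ramificationIdx'_ne_zero_of_liesOver _ v.ne_bot)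
  rw [hunder, hr, ← hv, WithZero.log_pow, nsmul_eq_mul]
  push_cast
  rw [mul_comm (Ideal.ramificationIdx' (v.asIdeal.under o) v.asIdeal : ℚ), ← mul_neg,
    mul_div_mul_left _ _ he]

variable (o : Type*) {K L : Type*} [CommRing o] [IsDedekindDomain o] [Fact (¬ IsField o)]
  [Field K] [Field L] [Algebra o K] [IsFractionRing o K] [Algebra K L] [Algebra o L]
  [IsScalarTower o K L] [Algebra.IsSeparable K L]

/-- The inclusion of the integral closure of `o` in an intermediate field `M` into the integral
closure of `o` in `L`. -/
def inclIntCl (M : IntermediateField K L) : IntCl o M →ₐ[o] IntCl o L :=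
  (M.val.restrictScalars o).mapIntegralClosure

variable {o}

/-- `P ∩ M`, a non-zero prime ideal of the integral closure of `o` in `M`. -/
def below (P : MaximalSpectrum (IntCl o L)) (M : IntermediateField K L) :
    IsDedekindDomain.HeightOneSpectrum (IntCl o M) where
  asIdeal := P.asIdeal.comap (inclIntCl o M)
  isPrime := by
    have := P.isMaximal.isPrime
    exact Ideal.comap_isPrime _ _
  ne_bot := by
    have := faithful_tower o K L
    have := faithful_tower o K M
    obtain ⟨x, hx, hx0⟩ := Submodule.exists_mem_ne_zero_of_ne_bot (intCl_ne_bot P)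
    have h := Ideal.comap_ne_bot_of_integral_mem (R := o) hx0 hx (Algebra.IsIntegral.isIntegral x)
    obtain ⟨c, hc, hc0⟩ := Submodule.exists_mem_ne_zero_of_ne_bot h
    refine (Submodule.ne_bot_iff _).2 ⟨algebraMap o (IntCl o M) c, ?_, ?_⟩
    · rw [Ideal.mem_comap, AlgHom.commutes]
      exact hc
    · exact (map_ne_zero_iff _ (FaithfulSMul.algebraMap_injective o (IntCl o M))).2 hc0

/-- For a finite subextension `M / K`, the valuation of `M` at `P ∩ M`, divided by the
ramification index of `P ∩ M` over `P ∩ o`; its restriction to `Kˣ` has image `ℤ`. -/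
def valAt (P : MaximalSpectrum (IntCl o L)) (M : IntermediateField K L) [FiniteDimensional K M]
    (x : Mˣ) : ℚ :=
  haveI : IsDedekindDomain (IntCl o M) := integralClosure.isDedekindDomain o K M
  haveI : IsFractionRing (IntCl o M) M :=
    IsIntegralClosure.isFractionRing_of_finite_extension o K M (IntCl o M)
  (-((WithZero.log ((below P M).valuation M (x : M)) : ℤ) : ℚ)) /
    (Ideal.ramificationIdx' ((below P M).asIdeal.under o) (below P M).asIdeal : ℚ)

theorem valAt_mul (P : MaximalSpectrum (IntCl o L)) (M : IntermediateField K L)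
    [FiniteDimensional K M] (x y : Mˣ) : valAt P M (x * y) = valAt P M x + valAt P M y := by
  have : IsDedekindDomain (IntCl o M) := integralClosure.isDedekindDomain o K M
  have : IsFractionRing (IntCl o M) M :=
    IsIntegralClosure.isFractionRing_of_finite_extension o K M (IntCl o M)
  unfold valAt
  rw [Units.val_mul, map_mul, WithZero.log_mul (by simp) (by simp)]
  push_cast
  ring

theorem valAt_eq_of_le (P : MaximalSpectrum (IntCl o L)) {M N : IntermediateField K L}
    [FiniteDimensional K M] [FiniteDimensional K N] (h : M ≤ N) (x : Mˣ) (y : Nˣ)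
    (hxy : ((x : M) : L) = ((y : N) : L)) : valAt P M x = valAt P N y := by
  have : IsDedekindDomain (IntCl o M) := integralClosure.isDedekindDomain o K M
  have : IsFractionRing (IntCl o M) M :=
    IsIntegralClosure.isFractionRing_of_finite_extension o K M (IntCl o M)
  have : IsDedekindDomain (IntCl o N) := integralClosure.isDedekindDomain o K N
  have : IsFractionRing (IntCl o N) N :=
    IsIntegralClosure.isFractionRing_of_finite_extension o K N (IntCl o N)
  have := faithful_tower o K M
  let i : M →ₐ[K] N := IntermediateField.inclusion h
  let j : IntCl o M →ₐ[o] IntCl o N := (i.restrictScalars o).mapIntegralClosure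
  let : Algebra M N := i.toRingHom.toAlgebra
  let aAB : Algebra (IntCl o M) (IntCl o N) := j.toRingHom.toAlgebra
  let aAN : Algebra (IntCl o M) N := ((algebraMap (IntCl o N) N).comp j.toRingHom).toAlgebra
  let : SMul (IntCl o M) (IntCl o N) := aAB.toSMul
  let : SMul (IntCl o M) N := aAN.toSMul
  have : IsScalarTower (IntCl o M) (IntCl o N) N := IsScalarTower.of_algebraMap_eq fun _ => rfl
  have : IsScalarTower (IntCl o M) M N := IsScalarTower.of_algebraMap_eq fun _ => rfl
  have : IsScalarTower o (IntCl o M) (IntCl o N) :=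
    IsScalarTower.of_algebraMap_eq fun c => (j.commutes c).symm
  have hj : Function.Injective j := by
    intro a b hab
    apply Subtype.ext
    apply i.toRingHom.injective
    exact congrArg Subtype.val hab
  have : FaithfulSMul (IntCl o M) (IntCl o N) :=
    (faithfulSMul_iff_algebraMap_injective _ _).2 hj
  have hxy' : algebraMap M N (x : M) = (y : N) := Subtype.ext hxy
  unfold valAt
  rw [← hxy']
  exact log_valuation_div (below P M) (below P N) rfl (x : M)

variable (K) in
theorem finiteDimensional_adjoin (x : L) : FiniteDimensional K (IntermediateField.adjoin K {x}) :=
  IntermediateField.adjoin.finiteDimensional (Algebra.IsIntegral.isIntegral x)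

variable (K)

/-- The additive valuation `v_P : Lˣ → ℚ` at `P`, normalized by `v_P(Kˣ) = ℤ`: the value at `x`
is computed in the finite extension `K(x)` of `K`. -/
def nval (P : MaximalSpectrum (IntCl o L)) (x : Lˣ) : ℚ :=
  haveI := finiteDimensional_adjoin K (x : L)
  valAt P (IntermediateField.adjoin K {(x : L)})
    (Units.mk0 ⟨(x : L), IntermediateField.mem_adjoin_simple_self K (x : L)⟩
      fun h => x.ne_zero (congrArg Subtype.val h))

/-- The value does not depend on the finite extension in which it is computed. -/
theorem nval_eq_valAt (P : MaximalSpectrum (IntCl o L)) (M : IntermediateField K L)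
    [FiniteDimensional K M] (x : Lˣ) (y : Mˣ) (h : (x : L) = ((y : M) : L)) :
    nval K P x = valAt P M y := by
  have := finiteDimensional_adjoin K (x : L)
  refine valAt_eq_of_le P ?_ _ _ h
  rw [IntermediateField.adjoin_simple_le_iff, h]
  exact (y : M).2

theorem nval_mul (P : MaximalSpectrum (IntCl o L)) (x y : Lˣ) :
    nval K P (x * y) = nval K P x + nval K P y := by
  have := finiteDimensional_adjoin K (x : L)
  have := finiteDimensional_adjoin K (y : L)
  let M : IntermediateField K L :=
    IntermediateField.adjoin K {(x : L)} ⊔ IntermediateField.adjoin K {(y : L)}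
  have hx : (x : L) ∈ M :=
    le_sup_left (a := IntermediateField.adjoin K {(x : L)})
      (IntermediateField.mem_adjoin_simple_self K (x : L))
  have hy : (y : L) ∈ M :=
    le_sup_right (b := IntermediateField.adjoin K {(y : L)})
      (IntermediateField.mem_adjoin_simple_self K (y : L))
  let x' : Mˣ := Units.mk0 ⟨(x : L), hx⟩ fun h => x.ne_zero (congrArg Subtype.val h)
  let y' : Mˣ := Units.mk0 ⟨(y : L), hy⟩ fun h => y.ne_zero (congrArg Subtype.val h)
  rw [nval_eq_valAt K P M x x' rfl, nval_eq_valAt K P M y y' rfl,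
    nval_eq_valAt K P M (x * y) (x' * y') rfl, valAt_mul]

theorem nval_one (P : MaximalSpectrum (IntCl o L)) : nval K P 1 = 0 := by
  have h := nval_mul K P 1 1
  rw [mul_one] at h
  linarith

/-- The value group `v_P(Lˣ)`, as a subset of `ℝ`. -/
def valueGroup (P : MaximalSpectrum (IntCl o L)) : Set ℝ :=
  Set.range fun x : Lˣ => (nval K P x : ℝ)

/-- The closure `V_P` of the value group in `ℝ`. -/
def valueClosure (P : MaximalSpectrum (IntCl o L)) : Set ℝ := closure (valueGroup K P)

/-- `val_P = {(α, 0) | α ∈ v_P(Lˣ)}`. -/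
def valSub (P : MaximalSpectrum (IntCl o L)) : AddSubmonoid RTilde where
  carrier := {a | a.fst ∈ valueGroup K P ∧ a.snd = false}
  zero_mem' := ⟨⟨1, by simp [nval_one]⟩, rfl⟩
  add_mem' := by
    rintro a b ⟨⟨x, hx⟩, ha⟩ ⟨⟨y, hy⟩, hb⟩
    refine ⟨⟨x * y, ?_⟩, by rw [RTilde.add_snd, ha, hb, max_self]⟩
    simp only at hx hy
    simp only [nval_mul, Rat.cast_add, RTilde.add_fst, hx, hy]

/-- `val_P ∪ {(β, 1) | β ∈ ℝ}` if `V_P = ℝ`, and `val_P` otherwise. -/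
def vTilde (P : MaximalSpectrum (IntCl o L)) : AddSubmonoid RTilde where
  carrier := {a | a ∈ valSub K P ∨ (a.snd = true ∧ valueClosure K P = Set.univ)}
  zero_mem' := Or.inl (valSub K P).zero_mem
  add_mem' := by
    rintro a b (ha | ⟨ha, h⟩) (hb | ⟨hb, h'⟩)
    · exact Or.inl ((valSub K P).add_mem ha hb)
    · exact Or.inr ⟨by rw [RTilde.add_snd, hb]; exact max_eq_right (Bool.le_true _), h'⟩
    · exact Or.inr ⟨by rw [RTilde.add_snd, ha]; exact max_eq_left (Bool.le_true _), h⟩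
    · exact Or.inr ⟨by rw [RTilde.add_snd, ha, hb, max_self], h⟩

/-- `f_I(P) = inf {v_P(x) | x ∈ I}`; the element `0`, of value `+∞`, is left out. -/
def fReal (I : Frac (IntCl o L) L) (P : MaximalSpectrum (IntCl o L)) : ℝ :=
  sInf {r | ∃ x : Lˣ, (x : L) ∈ I.1 ∧ r = (nval K P x : ℝ)}

/-- `P ∈ Max(I)`: the valuation `v_P` attains its minimum on `I`. -/
def InMax (I : Frac (IntCl o L) L) (P : MaximalSpectrum (IntCl o L)) : Prop :=
  ∃ x : Lˣ, (x : L) ∈ I.1 ∧ fReal K I P = (nval K P x : ℝ)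

open Classical in
/-- The value at `P` is `(f_I(P), 0)` if `P ∈ Max(I)`, and `(f_I(P), 1)` otherwise. -/
def fTilde (I : Frac (IntCl o L) L) (P : MaximalSpectrum (IntCl o L)) : RTilde :=
  ⟨fReal K I P, if InMax K I P then false else true⟩

/-- The space `G / D_P`, with the quotient of the Krull topology on `G = Gal(L/K)`. -/
abbrev DecompQuot (P : MaximalSpectrum (IntCl o L)) : Type _ := Gal(L/K) ⧸ Decomp K P

/-- `S(G/D_P; Ṽ_P) / Sref(G/D_P; val_P)`. -/
abbrev LocalM (P : MaximalSpectrum (IntCl o L)) : Type _ :=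
  QuotM (DecompQuot K P) (vTilde K P) (valSub K P)

/-- `Sref(G/D_P; Ṽ_P) / Sref(G/D_P; val_P)`, as a submonoid of
`S(G/D_P; Ṽ_P) / Sref(G/D_P; val_P)`. -/
def LocalN (P : MaximalSpectrum (IntCl o L)) : AddSubmonoid (LocalM K P) :=
  QuotN (DecompQuot K P) (vTilde K P) (valSub K P)

/-- The maximal ideals of `o` at which the value group in `L` is not equal to its closure,
that is, is not discrete; `pL` is a choice of a maximal ideal above each maximal ideal of `o`. -/
def RInf (pL : MaximalSpectrum o → MaximalSpectrum (IntCl o L)) : Set (MaximalSpectrum o) :=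
  {q | valueGroup K (pL q) ≠ valueClosure K (pL q)}

end Valuation

end

end IdealClassMonoid

open IdealClassMonoid

namespace IdealClassMonoid

noncomputable section

set_option linter.unusedSectionVars false

section NormalizedValuation

variable {o K L : Type*} [CommRing o] [IsDedekindDomain o] [Fact (¬ IsField o)]
  [Field K] [Field L] [Algebra o K] [IsFractionRing o K] [Algebra K L] [Algebra o L]
  [IsScalarTower o K L]

section Separable

variable [Algebra.IsSeparable K L]

/-- The ramification index occurring in `valAt` is positive. -/
theorem ramificationIdx_below_pos (P : MaximalSpectrum (IntCl o L)) (M : IntermediateField K L)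
    [FiniteDimensional K M] :
    0 < Ideal.ramificationIdx' ((below P M).asIdeal.under o) (below P M).asIdeal := by
  have : IsDedekindDomain (IntCl o M) := integralClosure.isDedekindDomain o K M
  have := faithful_tower o K M
  have : (below P M).asIdeal.LiesOver ((below P M).asIdeal.under o) := ⟨rfl⟩
  have := (below P M).isPrime
  refine Nat.pos_of_ne_zero (Ideal.IsDedekindDomain.ramificationIdx'_ne_zero_of_liesOver _ ?_)
  exact Ideal.IsIntegral.comap_ne_bot _ (below P M).ne_bot

theorem valAt_nonneg_iff (P : MaximalSpectrum (IntCl o L)) (M : IntermediateField K L)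
    [FiniteDimensional K M] [IsDedekindDomain (IntCl o M)] [IsFractionRing (IntCl o M) M] (x : Mˣ) :
    0 ≤ valAt P M x ↔ (below P M).valuation M (x : M) ≤ 1 := by
  have h0 : (below P M).valuation M (x : M) ≠ 0 := by simp
  have hr : (0 : ℚ) <
      (Ideal.ramificationIdx' ((below P M).asIdeal.under o) (below P M).asIdeal : ℚ) :=
    Nat.cast_pos.2 (ramificationIdx_below_pos P M)
  unfold valAt
  rw [le_div_iff₀ hr, zero_mul, neg_nonneg, Int.cast_nonpos, ← WithZero.log_one,
    WithZero.log_le_log h0 one_ne_zero]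

theorem valAt_pos_iff (P : MaximalSpectrum (IntCl o L)) (M : IntermediateField K L)
    [FiniteDimensional K M] [IsDedekindDomain (IntCl o M)] [IsFractionRing (IntCl o M) M] (x : Mˣ) :
    0 < valAt P M x ↔ (below P M).valuation M (x : M) < 1 := by
  have h0 : (below P M).valuation M (x : M) ≠ 0 := by simp
  have hr : (0 : ℚ) <
      (Ideal.ramificationIdx' ((below P M).asIdeal.under o) (below P M).asIdeal : ℚ) :=
    Nat.cast_pos.2 (ramificationIdx_below_pos P M)
  unfold valAt
  rw [lt_div_iff₀ hr, zero_mul, neg_pos, Int.cast_lt_zero, ← WithZero.log_one,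
    WithZero.log_lt_log h0 one_ne_zero]

variable (K) in
/-- A non-zero element of `L` lies in a finite subextension, in which its value can be computed. -/
theorem exists_nval_eq_valAt (x : Lˣ) : ∃ (M : IntermediateField K L) (_ : FiniteDimensional K M)
    (y : Mˣ), (x : L) = ((y : M) : L) ∧
      ∀ P : MaximalSpectrum (IntCl o L), nval K P x = valAt P M y :=
  ⟨IntermediateField.adjoin K {(x : L)}, finiteDimensional_adjoin K (x : L),
    Units.mk0 ⟨(x : L), IntermediateField.mem_adjoin_simple_self K (x : L)⟩
      fun h => x.ne_zero (congrArg Subtype.val h), rfl, fun _ => rfl⟩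

theorem nval_nonneg_of_mem (P : MaximalSpectrum (IntCl o L)) (x : Lˣ)
    (hx : (x : L) ∈ integralClosure o L) : 0 ≤ nval K P x := by
  obtain ⟨M, _, y, hy, h⟩ := exists_nval_eq_valAt (o := o) K x
  have : IsDedekindDomain (IntCl o M) := integralClosure.isDedekindDomain o K M
  have : IsFractionRing (IntCl o M) M :=
    IsIntegralClosure.isFractionRing_of_finite_extension o K M (IntCl o M)
  have hy' : IsIntegral o (y : M) :=
    (isIntegral_algHom_iff (M.val.restrictScalars o) M.val.injective).1 (by
      change IsIntegral o ((y : M) : L)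
      rw [← hy]; exact hx)
  rw [h, valAt_nonneg_iff]
  exact (below P M).valuation_le_one (⟨y, hy'⟩ : IntCl o M)

theorem nval_pos_iff (P : MaximalSpectrum (IntCl o L)) (x : Lˣ) (a : IntCl o L)
    (hx : (x : L) = a) : 0 < nval K P x ↔ a ∈ P.asIdeal := by
  obtain ⟨M, _, y, hy, h⟩ := exists_nval_eq_valAt (o := o) K x
  have : IsDedekindDomain (IntCl o M) := integralClosure.isDedekindDomain o K M
  have : IsFractionRing (IntCl o M) M :=
    IsIntegralClosure.isFractionRing_of_finite_extension o K M (IntCl o M)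
  have hy' : IsIntegral o (y : M) :=
    (isIntegral_algHom_iff (M.val.restrictScalars o) M.val.injective).1 (by
      change IsIntegral o ((y : M) : L)
      rw [← hy, hx]; exact a.2)
  rw [h, valAt_pos_iff]
  refine ((below P M).valuation_lt_one_iff_mem (⟨y, hy'⟩ : IntCl o M)).trans ?_
  have : inclIntCl o M (⟨y, hy'⟩ : IntCl o M) = a := Subtype.ext (hy.symm.trans hx)
  rw [← this]; rfl

theorem nval_eq_zero_iff (P : MaximalSpectrum (IntCl o L)) (x : Lˣ) (a : IntCl o L)
    (hx : (x : L) = a) : nval K P x = 0 ↔ a ∉ P.asIdeal := by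
  have h0 := nval_nonneg_of_mem (K := K) P x (by rw [hx]; exact a.2)
  rw [← nval_pos_iff (K := K) P x a hx, not_lt]
  exact ⟨fun h => h.le, fun h => le_antisymm h h0⟩

theorem exists_mul_mem_of_nval_nonneg (P : MaximalSpectrum (IntCl o L)) (x : Lˣ)
    (hx : 0 ≤ nval K P x) : ∃ s : IntCl o L, s ∉ P.asIdeal ∧ (s : L) * x ∈ integralClosure o L := by
  obtain ⟨M, _, y, hy, h⟩ := exists_nval_eq_valAt (o := o) K x
  have : IsDedekindDomain (IntCl o M) := integralClosure.isDedekindDomain o K M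
  have : IsFractionRing (IntCl o M) M :=
    IsIntegralClosure.isFractionRing_of_finite_extension o K M (IntCl o M)
  rw [h, valAt_nonneg_iff] at hx
  obtain ⟨n, d, hd⟩ := (below P M).exists_primeCompl_mul_eq_of_integer (y : M) hx
  refine ⟨inclIntCl o M d, d.2, ?_⟩
  have : ((inclIntCl o M d : IntCl o L) : L) * x = (inclIntCl o M n : IntCl o L) := by
    rw [hy, mul_comm]
    exact congrArg (fun z : M => (z : L)) hd
  rw [this]
  exact (inclIntCl o M n).2

theorem nval_inv (P : MaximalSpectrum (IntCl o L)) (x : Lˣ) : nval K P x⁻¹ = -nval K P x := by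
  have h := nval_mul K P x x⁻¹
  rw [mul_inv_cancel, nval_one] at h
  linarith

theorem nval_pow (P : MaximalSpectrum (IntCl o L)) (x : Lˣ) (n : ℕ) :
    nval K P (x ^ n) = n * nval K P x := by
  induction n with
  | zero => simp [nval_one]
  | succ n ih => rw [pow_succ, nval_mul, ih]; push_cast; ring

theorem nval_add_of_le (P : MaximalSpectrum (IntCl o L)) (x y z : Lˣ) (h : (z : L) = x + y)
    (hxy : nval K P x ≤ nval K P y) : nval K P x ≤ nval K P z := by
  obtain ⟨s, hs, hsx⟩ := exists_mul_mem_of_nval_nonneg P (y * x⁻¹)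
    (by rw [nval_mul, nval_inv]; linarith : 0 ≤ nval K P (y * x⁻¹))
  have hs0 : (s : L) ≠ 0 := fun h0 => hs (by
    rw [show s = 0 from Subtype.ext h0]; exact zero_mem _)
  have hv := (nval_eq_zero_iff (K := K) P (Units.mk0 (s : L) hs0) s rfl).2 hs
  have hz : ((Units.mk0 (s : L) hs0 * (z * x⁻¹) : Lˣ) : L) ∈ integralClosure o L := by
    have : ((Units.mk0 (s : L) hs0 * (z * x⁻¹) : Lˣ) : L) = s + s * ((y * x⁻¹ : Lˣ) : L) := by
      push_cast
      rw [h, Units.val_mk0]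
      have := x.ne_zero
      field_simp
    rw [this]
    exact add_mem s.2 hsx
  have h1 := nval_nonneg_of_mem (K := K) P _ hz
  rw [nval_mul, nval_mul, nval_inv, hv] at h1
  linarith

theorem mem_of_forall_nval_nonneg (x : Lˣ)
    (hx : ∀ P : MaximalSpectrum (IntCl o L), 0 ≤ nval K P x) : (x : L) ∈ integralClosure o L := by
  let J : Ideal (IntCl o L) :=
    { carrier := {s | (s : L) * x ∈ integralClosure o L}
      add_mem' := fun {a b} ha hb => by
        change ((a : L) + b) * x ∈ integralClosure o L
        rw [add_mul]; exact add_mem ha hb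
      zero_mem' := by
        change (0 : L) * x ∈ integralClosure o L
        rw [zero_mul]; exact zero_mem _
      smul_mem' := fun c {a} ha => by
        change ((c : L) * a) * x ∈ integralClosure o L
        rw [mul_assoc]; exact mul_mem c.2 ha }
  have hJ : J = ⊤ := by
    by_contra hne
    obtain ⟨P, hP, hJP⟩ := J.exists_le_maximal hne
    obtain ⟨s, hs, hsx⟩ := exists_mul_mem_of_nval_nonneg (K := K) ⟨P, hP⟩ x (hx _)
    exact hs (hJP hsx)
  have h1 : (1 : IntCl o L) ∈ J := hJ ▸ Submodule.mem_top
  have h2 : ((1 : L)) * x ∈ integralClosure o L := h1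
  rwa [one_mul] at h2

/-- Values are compatible with isomorphisms of finite subextensions that match the primes. -/
theorem valAt_eq_of_algHom (P Q : MaximalSpectrum (IntCl o L)) {M N : IntermediateField K L}
    [FiniteDimensional K M] [FiniteDimensional K N] (i : M →ₐ[K] N)
    (hPQ : (below P M).asIdeal =
      (below Q N).asIdeal.comap (i.restrictScalars o).mapIntegralClosure)
    (x : Mˣ) (y : Nˣ) (hxy : i x = y) : valAt P M x = valAt Q N y := by
  have : IsDedekindDomain (IntCl o M) := integralClosure.isDedekindDomain o K M
  have : IsFractionRing (IntCl o M) M :=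
    IsIntegralClosure.isFractionRing_of_finite_extension o K M (IntCl o M)
  have : IsDedekindDomain (IntCl o N) := integralClosure.isDedekindDomain o K N
  have : IsFractionRing (IntCl o N) N :=
    IsIntegralClosure.isFractionRing_of_finite_extension o K N (IntCl o N)
  have := faithful_tower o K M
  let j : IntCl o M →ₐ[o] IntCl o N := (i.restrictScalars o).mapIntegralClosure
  let : Algebra M N := i.toRingHom.toAlgebra
  let aAB : Algebra (IntCl o M) (IntCl o N) := j.toRingHom.toAlgebra
  let aAN : Algebra (IntCl o M) N := ((algebraMap (IntCl o N) N).comp j.toRingHom).toAlgebra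
  let : SMul (IntCl o M) (IntCl o N) := aAB.toSMul
  let : SMul (IntCl o M) N := aAN.toSMul
  have : IsScalarTower (IntCl o M) (IntCl o N) N := IsScalarTower.of_algebraMap_eq fun _ => rfl
  have : IsScalarTower (IntCl o M) M N := IsScalarTower.of_algebraMap_eq fun _ => rfl
  have : IsScalarTower o (IntCl o M) (IntCl o N) :=
    IsScalarTower.of_algebraMap_eq fun c => (j.commutes c).symm
  have hj : Function.Injective j := by
    intro a b hab
    apply Subtype.ext
    apply i.toRingHom.injective
    exact congrArg Subtype.val hab
  have : FaithfulSMul (IntCl o M) (IntCl o N) :=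
    (faithfulSMul_iff_algebraMap_injective _ _).2 hj
  have hxy' : algebraMap M N (x : M) = (y : N) := hxy
  unfold valAt
  rw [← hxy']
  exact log_valuation_div (below P M) (below Q N) hPQ (x : M)

theorem nval_smul (σ : Gal(L/K)) (P : MaximalSpectrum (IntCl o L)) (x : Lˣ) :
    nval K (σ • P) (Units.map (σ : L →* L) x) = nval K P x := by
  obtain ⟨M, _, y, hy, h⟩ := exists_nval_eq_valAt (o := o) K x
  let N := M.map (σ : L →ₐ[K] L)
  let i : M ≃ₐ[K] N := M.equivMap (σ : L →ₐ[K] L)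
  have : FiniteDimensional K N := i.toLinearEquiv.finiteDimensional
  have hi : ∀ m : M, ((i m : N) : L) = σ m := fun m => rfl
  let y' : Nˣ := Units.map (i : M →* N) y
  have h' : ((Units.map (σ : L →* L) x : Lˣ) : L) = ((y' : N) : L) := by
    change σ x = σ ((y : M) : L)
    rw [hy]
  rw [h, nval_eq_valAt K (σ • P) N _ y' h']
  symm
  refine valAt_eq_of_algHom P (σ • P) (i : M →ₐ[K] N) ?_ y y' rfl
  ext a
  change inclIntCl o M a ∈ P.asIdeal ↔ inclIntCl o N _ ∈ σ • P.asIdeal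
  rw [← Ideal.smul_mem_pointwise_smul_iff (a := σ)]
  rfl

end Separable

end NormalizedValuation

theorem isAlgebraic_base (o K L : Type*) [CommRing o] [IsDomain o] [Field K] [Field L]
    [Algebra o K] [IsFractionRing o K] [Algebra K L] [Algebra o L] [IsScalarTower o K L]
    [Algebra.IsAlgebraic K L] : Algebra.IsAlgebraic o L :=
  (IsFractionRing.comap_isAlgebraic_iff (A := o) (K := K) (C := L)).2 inferInstance

theorem isFractionRing_intCl (o K L : Type*) [CommRing o] [IsDomain o] [Field K] [Field L]
    [Algebra o K] [IsFractionRing o K] [Algebra K L] [Algebra o L] [IsScalarTower o K L]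
    [Algebra.IsAlgebraic K L] : IsFractionRing (IntCl o L) L :=
  have := faithful_tower o K L
  have := isAlgebraic_base o K L
  integralClosure.isFractionRing_of_algebraic
    ((injective_iff_map_eq_zero _).1 (FaithfulSMul.algebraMap_injective o L))

section PrimeFibres

variable {o K L : Type*} [CommRing o] [IsDedekindDomain o] [Fact (¬ IsField o)]
  [Field K] [Field L] [Algebra o K] [IsFractionRing o K] [Algebra K L] [Algebra o L]
  [IsScalarTower o K L] [IsGalois K L]

variable (o K L) in
theorem isInvariant_intCl : Algebra.IsInvariant o (IntCl o L) Gal(L/K) := by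
  refine ⟨fun b hb => ?_⟩
  obtain ⟨k, hk⟩ := (InfiniteGalois.mem_range_algebraMap_iff_fixed (k := K) (b : L)).2
    fun σ => congrArg Subtype.val (hb σ)
  have hint : IsIntegral o k := by
    refine (isIntegral_algHom_iff (IsScalarTower.toAlgHom o K L) (algebraMap K L).injective).1 ?_
    change IsIntegral o (algebraMap K L k)
    rw [hk]; exact b.2
  obtain ⟨a, ha⟩ := IsIntegrallyClosed.isIntegral_iff.1 hint
  refine ⟨a, Subtype.ext ?_⟩
  change algebraMap o L a = b
  rw [IsScalarTower.algebraMap_apply o K L, ha, hk]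

/-- `Gal(L/K)` acts transitively on the maximal ideals above a given one. -/
theorem exists_smul_eq_of_under_eq (P Q : MaximalSpectrum (IntCl o L))
    (h : P.asIdeal.under o = Q.asIdeal.under o) : ∃ σ : Gal(L/K), Q = σ • P := by
  have := isInvariant_intCl o K L
  let : TopologicalSpace (IntCl o L) := ⊥
  have : DiscreteTopology (IntCl o L) := ⟨rfl⟩
  have : ContinuousSMul Gal(L/K) (IntCl o L) := by
    rw [continuousSMul_iff_stabilizer_isOpen]
    intro x
    convert stabilizer_isOpen_of_isIntegral (K := K) (x : L) using 1
    ext σ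
    exact Subtype.ext_iff
  have := P.isMaximal.isPrime
  have := Q.isMaximal.isPrime
  obtain ⟨σ, hσ⟩ := Algebra.IsInvariant.exists_smul_of_under_eq_of_profinite
    (A := o) (G := Gal(L/K)) P.asIdeal Q.asIdeal h
  exact ⟨σ, MaximalSpectrum.ext hσ⟩

variable (K) in
/-- The point `σ(P)` of the fibre through `P` that belongs to `σ D_P`. -/
def fibrePt (P : MaximalSpectrum (IntCl o L)) (q : DecompQuot K P) : MaximalSpectrum (IntCl o L) :=
  MulAction.ofQuotientStabilizer Gal(L/K) P q

@[simp] theorem fibrePt_mk (P : MaximalSpectrum (IntCl o L)) (σ : Gal(L/K)) :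
    fibrePt K P (QuotientGroup.mk σ) = σ • P := rfl

theorem fibrePt_smul (P : MaximalSpectrum (IntCl o L)) (σ : Gal(L/K)) (q : DecompQuot K P) :
    fibrePt K P (σ • q) = σ • fibrePt K P q :=
  MulAction.ofQuotientStabilizer_smul Gal(L/K) P σ q

theorem fibrePt_injective (P : MaximalSpectrum (IntCl o L)) :
    Function.Injective (fibrePt K P) :=
  MulAction.injective_ofQuotientStabilizer Gal(L/K) P

theorem nval_smul_eq (σ : Gal(L/K)) (P : MaximalSpectrum (IntCl o L)) (x : Lˣ) :
    nval K (σ • P) x = nval K P (Units.map ((σ⁻¹ : Gal(L/K)) : L →* L) x) := by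
  have h := nval_smul σ⁻¹ (σ • P) x
  rw [inv_smul_smul] at h
  exact h.symm

theorem isLocallyConstant_nval (P : MaximalSpectrum (IntCl o L)) (x : Lˣ) :
    IsLocallyConstant fun q : DecompQuot K P => nval K (fibrePt K P q) x := by
  have h : IsLocallyConstant fun σ : Gal(L/K) => nval K (σ • P) x := by
    rw [IsLocallyConstant.iff_exists_open]
    intro σ
    refine ⟨{τ | τ⁻¹ • (x : L) = σ⁻¹ • (x : L)}, ?_, rfl, ?_⟩
    · have hs := (stabilizer_isOpen_of_isIntegral (K := K) (x : L)).preimage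
        (continuous_mul_const σ⁻¹)
      convert hs using 1
      ext τ
      simp only [Set.mem_ofPred_eq, Set.mem_preimage, SetLike.mem_coe, MulAction.mem_stabilizer_iff,
        mul_smul]
      rw [inv_smul_eq_iff, eq_comm]
    · intro τ hτ
      rw [nval_smul_eq, nval_smul_eq]
      exact congrArg (nval K P) (Units.ext hτ)
  intro s
  rw [← (QuotientGroup.isQuotientMap_mk (Decomp K P)).isOpen_preimage]
  exact h s

theorem exists_nat_abs_nval_le (P : MaximalSpectrum (IntCl o L)) (x : Lˣ) :
    ∃ N : ℕ, ∀ q : DecompQuot K P, |nval K (fibrePt K P q) x| ≤ N := by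
  have hf := (isLocallyConstant_nval (K := K) P x).range_finite
  obtain ⟨B, hB⟩ := (hf.image fun r => |r|).bddAbove
  obtain ⟨N, hN⟩ := exists_nat_ge B
  exact ⟨N, fun q => (hB ⟨_, ⟨q, rfl⟩, rfl⟩).trans hN⟩

theorem valueGroup_smul (σ : Gal(L/K)) (P : MaximalSpectrum (IntCl o L)) :
    valueGroup K (σ • P) = valueGroup K P := by
  have h : ∀ (σ : Gal(L/K)) (P : MaximalSpectrum (IntCl o L)),
      valueGroup K (σ • P) ⊆ valueGroup K P := by
    rintro σ P _ ⟨x, rfl⟩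
    exact ⟨_, congrArg Rat.cast (nval_smul_eq σ P x).symm⟩
  refine (h σ P).antisymm ?_
  have := h σ⁻¹ (σ • P)
  rwa [inv_smul_smul] at this

theorem vTilde_smul (σ : Gal(L/K)) (P : MaximalSpectrum (IntCl o L)) :
    vTilde K (σ • P) = vTilde K P := by
  ext a
  change (a.fst ∈ valueGroup K (σ • P) ∧ _) ∨ (_ ∧ closure (valueGroup K (σ • P)) = _) ↔ _
  rw [valueGroup_smul]
  rfl

theorem vTilde_fibrePt (P : MaximalSpectrum (IntCl o L)) (q : DecompQuot K P) :
    vTilde K (fibrePt K P q) = vTilde K P := by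
  induction q using QuotientGroup.induction_on with
  | H σ => exact vTilde_smul σ P

theorem under_smul (σ : Gal(L/K)) (P : MaximalSpectrum (IntCl o L)) :
    (σ • P).asIdeal.under o = P.asIdeal.under o := by
  ext a
  change algebraMap o (IntCl o L) a ∈ σ • P.asIdeal ↔ algebraMap o (IntCl o L) a ∈ P.asIdeal
  rw [Ideal.mem_pointwise_smul_iff_inv_smul_mem, smul_algebraMap]

theorem under_fibrePt (P : MaximalSpectrum (IntCl o L)) (q : DecompQuot K P) :
    (fibrePt K P q).asIdeal.under o = P.asIdeal.under o := by
  induction q using QuotientGroup.induction_on with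
  | H σ => exact under_smul σ P

theorem exists_fibrePt_eq (P Q : MaximalSpectrum (IntCl o L))
    (h : P.asIdeal.under o = Q.asIdeal.under o) : ∃ q : DecompQuot K P, fibrePt K P q = Q := by
  obtain ⟨σ, hσ⟩ := exists_smul_eq_of_under_eq (K := K) P Q h
  exact ⟨QuotientGroup.mk σ, hσ.symm⟩

/-! ### Values of elements of the base ring -/

variable (K L) in
/-- A non-zero element of `o` as a unit of `L`. -/
def baseUnit (c : o) (hc : c ≠ 0) : Lˣ :=
  haveI := faithful_tower o K L
  Units.mk0 (algebraMap o L c) ((map_ne_zero_iff _ (FaithfulSMul.algebraMap_injective o L)).2 hc)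

theorem nval_baseUnit_nonneg (P : MaximalSpectrum (IntCl o L)) (c : o) (hc : c ≠ 0) :
    0 ≤ nval K P (baseUnit K L c hc) :=
  nval_nonneg_of_mem P _ (algebraMap o (IntCl o L) c).2

theorem nval_baseUnit_pos_iff (P : MaximalSpectrum (IntCl o L)) (c : o) (hc : c ≠ 0) :
    0 < nval K P (baseUnit K L c hc) ↔ c ∈ P.asIdeal.under o :=
  nval_pos_iff P _ (algebraMap o (IntCl o L) c) rfl

theorem nval_baseUnit_eq_zero_iff (P : MaximalSpectrum (IntCl o L)) (c : o) (hc : c ≠ 0) :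
    nval K P (baseUnit K L c hc) = 0 ↔ c ∉ P.asIdeal.under o :=
  nval_eq_zero_iff P _ (algebraMap o (IntCl o L) c) rfl

variable (K) in
theorem exists_baseUnit_mul_mem (x : Lˣ) :
    ∃ (c : o) (hc : c ≠ 0), ((baseUnit K L c hc * x : Lˣ) : L) ∈ integralClosure o L := by
  have := isAlgebraic_base o K L
  obtain ⟨c, hc, h⟩ := (Algebra.IsAlgebraic.isAlgebraic (R := o) (x : L)).exists_integral_multiple
  refine ⟨c, hc, ?_⟩
  change algebraMap o L c * x ∈ _
  rw [← Algebra.smul_def]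
  exact h

variable (K) in
/-- The values of `x` are bounded in terms of those of non-zero elements of `o`. -/
theorem exists_baseUnit_le_nval (x : Lˣ) : ∃ (c : o) (hc : c ≠ 0),
    ∀ P : MaximalSpectrum (IntCl o L), |nval K P x| ≤ nval K P (baseUnit K L c hc) := by
  obtain ⟨c, hc, h⟩ := exists_baseUnit_mul_mem (o := o) K x
  obtain ⟨d, hd, h'⟩ := exists_baseUnit_mul_mem (o := o) K x⁻¹
  refine ⟨c * d, mul_ne_zero hc hd, fun P => ?_⟩
  have e : baseUnit K L (c * d) (mul_ne_zero hc hd) = baseUnit K L c hc * baseUnit K L d hd :=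
    Units.ext (map_mul _ _ _)
  have h1 := nval_nonneg_of_mem (K := K) P _ h
  have h2 := nval_nonneg_of_mem (K := K) P _ h'
  rw [nval_mul] at h1 h2
  rw [nval_inv] at h2
  have h3 := nval_baseUnit_nonneg (K := K) P c hc
  have h4 := nval_baseUnit_nonneg (K := K) P d hd
  rw [e, nval_mul, abs_le]
  constructor <;> linarith

theorem finite_maximalSpectrum_mem (c : o) (hc : c ≠ 0) :
    {p : MaximalSpectrum o | c ∈ p.asIdeal}.Finite := by
  have h := Ideal.finite_factors (I := Ideal.span {c}) (by simpa using hc)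
  refine Set.Finite.of_injOn (f := fun p : MaximalSpectrum o =>
    (⟨p.asIdeal, p.isMaximal.isPrime,
      Ring.ne_bot_of_isMaximal_of_not_isField p.isMaximal Fact.out⟩ :
      IsDedekindDomain.HeightOneSpectrum o)) ?_ ?_ h
  · intro p hp
    exact Ideal.dvd_span_singleton.2 hp
  · intro p _ q _ hpq
    exact MaximalSpectrum.ext (congrArg IsDedekindDomain.HeightOneSpectrum.asIdeal hpq)

end PrimeFibres

namespace RTilde

theorem le_mk_false_iff {a : RTilde} {α : ℝ} :
    a ≤ ⟨α, false⟩ ↔ a.fst < α ∨ a.fst = α ∧ a.snd = false := by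
  rw [le_iff]; simp [show ∀ s : Bool, s ≤ false ↔ s = false by decide]

theorem mk_false_le_mk_false {α β : ℝ} (h : α ≤ β) :
    (⟨α, false⟩ : RTilde) ≤ ⟨β, false⟩ := by
  rw [le_mk_false_iff]
  exact h.lt_or_eq.imp id fun h => ⟨h, rfl⟩

theorem fst_le_of_le_mk {a : RTilde} {α : ℝ} (h : a ≤ ⟨α, false⟩) : a.fst ≤ α :=
  (le_mk_false_iff.1 h).elim le_of_lt fun h => h.1.le

theorem lt_mk_true_iff {a : RTilde} {α : ℝ} : a < ⟨α, true⟩ ↔ a ≤ ⟨α, false⟩ := by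
  rw [le_mk_false_iff, lt_iff]; simp [show ∀ s : Bool, s < true ↔ s = false by decide]

theorem lt_mk_false_iff {a : RTilde} {α : ℝ} : a < ⟨α, false⟩ ↔ ∃ γ < α, a ≤ ⟨γ, false⟩ := by
  have h : a < ⟨α, false⟩ ↔ a.fst < α := by
    rw [lt_iff]; simp [show ∀ s : Bool, ¬ s < false by decide]
  rw [h]
  constructor
  · intro h
    obtain ⟨γ, h1, h2⟩ := exists_between h
    exact ⟨γ, h2, le_mk_false_iff.2 (Or.inl h1)⟩
  · rintro ⟨γ, h1, h2⟩
    exact (fst_le_of_le_mk h2).trans_lt h1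

/-- An element of `ℝ × {0, 1}` is determined by the numbers `(α, 0)` above it. -/
theorem le_of_forall_le_mk {a b : RTilde}
    (h : ∀ α : ℝ, b ≤ ⟨α, false⟩ → a ≤ ⟨α, false⟩) : a ≤ b := by
  obtain ⟨β, _ | _⟩ := b
  · exact h β le_rfl
  · have h' : a.fst ≤ β := le_of_forall_gt_imp_ge_of_dense fun α hα =>
      fst_le_of_le_mk (h α (le_mk_false_iff.2 (Or.inl hα)))
    rw [le_iff]
    rcases h'.lt_or_eq with h' | h'
    · exact Or.inl h'
    · exact Or.inr ⟨h', Bool.le_true _⟩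

theorem exists_add_eq_of_add_le {a b : RTilde} {γ : ℝ} (h : a + b ≤ ⟨γ, false⟩) :
    ∃ α β : ℝ, α + β = γ ∧ a ≤ ⟨α, false⟩ ∧ b ≤ ⟨β, false⟩ := by
  rcases le_mk_false_iff.1 h with h | ⟨h, hs⟩
  · rw [add_fst] at h
    refine ⟨a.fst + (γ - a.fst - b.fst) / 2, b.fst + (γ - a.fst - b.fst) / 2, by ring, ?_, ?_⟩ <;>
    · rw [le_mk_false_iff]; left; linarith
  · rw [add_fst] at h
    rw [add_snd, (by decide : ∀ s t : Bool, max s t = false ↔ s = false ∧ t = false)] at hs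
    exact ⟨a.fst, b.fst, h, le_mk_false_iff.2 (Or.inr ⟨rfl, hs.1⟩),
      le_mk_false_iff.2 (Or.inr ⟨rfl, hs.2⟩)⟩

theorem add_iota_self {a : RTilde} (h : a.snd = false) : a + iota a = 0 :=
  RTilde.ext (add_neg_cancel a.fst) (by rw [add_snd]; simp [iota, h])

end RTilde

section FractionalIdeals

variable {o K L : Type*} [CommRing o] [IsDedekindDomain o] [Fact (¬ IsField o)]
  [Field K] [Field L] [Algebra o K] [IsFractionRing o K] [Algebra K L] [Algebra o L]
  [IsScalarTower o K L] [IsGalois K L]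

theorem exists_unit_mem (I : Frac (IntCl o L) L) : ∃ x : Lˣ, (x : L) ∈ I.1 := by
  have h : I.1 ≠ 0 := I.2
  rw [ne_eq, FractionalIdeal.eq_zero_iff] at h
  push Not at h
  obtain ⟨x, hx, hx0⟩ := h
  exact ⟨Units.mk0 x hx0, hx⟩

variable (K) in
/-- The values of the elements of a fractional ideal are bounded below by those of some `u`. -/
theorem exists_le_nval_of_mem (I : Frac (IntCl o L) L) : ∃ u : Lˣ, ∀ x : Lˣ, (x : L) ∈ I.1 →
    ∀ P : MaximalSpectrum (IntCl o L), nval K P u ≤ nval K P x := by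
  obtain ⟨d, hd, h⟩ := I.1.isFractional
  have hd0 : (d : L) ≠ 0 := fun h0 => nonZeroDivisors.ne_zero hd (Subtype.ext h0)
  refine ⟨(Units.mk0 (d : L) hd0)⁻¹, fun x hx P => ?_⟩
  obtain ⟨c, hc⟩ := h x hx
  have hc' : ((Units.mk0 (d : L) hd0 * x : Lˣ) : L) = c := hc.symm
  have := nval_nonneg_of_mem (K := K) P (Units.mk0 (d : L) hd0 * x) (by rw [hc']; exact c.2)
  rw [nval_mul] at this
  rw [nval_inv]
  linarith

variable (K) in
theorem bddBelow_nval (I : Frac (IntCl o L) L) (P : MaximalSpectrum (IntCl o L)) :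
    BddBelow {r | ∃ x : Lˣ, (x : L) ∈ I.1 ∧ r = (nval K P x : ℝ)} := by
  obtain ⟨u, hu⟩ := exists_le_nval_of_mem K I
  refine ⟨(nval K P u : ℝ), ?_⟩
  rintro _ ⟨x, hx, rfl⟩
  exact_mod_cast hu x hx P

theorem fReal_le_nval (I : Frac (IntCl o L) L) (P : MaximalSpectrum (IntCl o L)) {x : Lˣ}
    (hx : (x : L) ∈ I.1) : fReal K I P ≤ nval K P x := by
  unfold fReal
  exact csInf_le (bddBelow_nval K I P) ⟨x, hx, rfl⟩

theorem exists_nval_lt (I : Frac (IntCl o L) L) (P : MaximalSpectrum (IntCl o L)) {r : ℝ}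
    (h : fReal K I P < r) : ∃ x : Lˣ, (x : L) ∈ I.1 ∧ (nval K P x : ℝ) < r := by
  unfold fReal at h
  obtain ⟨x₀, hx₀⟩ := exists_unit_mem I
  have hne : {r | ∃ x : Lˣ, (x : L) ∈ I.1 ∧ r = (nval K P x : ℝ)}.Nonempty := ⟨_, x₀, hx₀, rfl⟩
  obtain ⟨_, ⟨x, hx, rfl⟩, hlt⟩ := exists_lt_of_csInf_lt hne h
  exact ⟨x, hx, hlt⟩

theorem fTilde_le_iff (I : Frac (IntCl o L) L) (P : MaximalSpectrum (IntCl o L)) (α : ℝ) :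
    fTilde K I P ≤ ⟨α, false⟩ ↔ ∃ x : Lˣ, (x : L) ∈ I.1 ∧ (nval K P x : ℝ) ≤ α := by
  rw [RTilde.le_mk_false_iff]
  constructor
  · rintro (h | ⟨h, hs⟩)
    · obtain ⟨x, hx, hlt⟩ := exists_nval_lt I P h
      exact ⟨x, hx, hlt.le⟩
    · have hm : InMax K I P := by
        by_contra hm
        simp [fTilde, hm] at hs
      obtain ⟨x, hx, he⟩ := hm
      exact ⟨x, hx, by rw [← he]; exact h.le⟩
  · rintro ⟨x, hx, hα⟩
    have hle := fReal_le_nval (K := K) I P hx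
    rcases (hle.trans hα).lt_or_eq with h | h
    · exact Or.inl h
    · have hm : InMax K I P := ⟨x, hx, le_antisymm hle (by rw [h]; exact hα)⟩
      exact Or.inr ⟨h, by simp [fTilde, hm]⟩

theorem fTilde_le_nval (I : Frac (IntCl o L) L) (P : MaximalSpectrum (IntCl o L)) {x : Lˣ}
    (hx : (x : L) ∈ I.1) : fTilde K I P ≤ ⟨nval K P x, false⟩ :=
  (fTilde_le_iff I P _).2 ⟨x, hx, le_rfl⟩

theorem exists_mul_nval_le (I J : Frac (IntCl o L) L) (P : MaximalSpectrum (IntCl o L)) {z : L}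
    (hz : z ∈ (I * J).1) (w : Lˣ) (hw : (w : L) = z) :
    ∃ x y : Lˣ, (x : L) ∈ I.1 ∧ (y : L) ∈ J.1 ∧ nval K P x + nval K P y ≤ nval K P w := by
  revert w
  refine FractionalIdeal.mul_induction_on (C := fun z => ∀ w : Lˣ, (w : L) = z →
    ∃ x y : Lˣ, (x : L) ∈ I.1 ∧ (y : L) ∈ J.1 ∧ nval K P x + nval K P y ≤ nval K P w) hz ?_ ?_
  · intro i hi j hj w hw
    have h0 : i * j ≠ 0 := hw ▸ w.ne_zero
    refine ⟨Units.mk0 i (left_ne_zero_of_mul h0), Units.mk0 j (right_ne_zero_of_mul h0), hi, hj, ?_⟩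
    rw [← nval_mul]
    refine (congrArg (nval K P) (Units.ext ?_)).le
    exact hw.symm
  · intro a b ha hb w hw
    by_cases ha0 : a = 0
    · exact hb w (by rw [hw, ha0, zero_add])
    by_cases hb0 : b = 0
    · exact ha w (by rw [hw, hb0, add_zero])
    rcases le_total (nval K P (Units.mk0 a ha0)) (nval K P (Units.mk0 b hb0)) with h | h
    · obtain ⟨x, y, hx, hy, hxy⟩ := ha (Units.mk0 a ha0) rfl
      exact ⟨x, y, hx, hy, hxy.trans (nval_add_of_le P _ (Units.mk0 b hb0) w hw h)⟩
    · obtain ⟨x, y, hx, hy, hxy⟩ := hb (Units.mk0 b hb0) rfl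
      exact ⟨x, y, hx, hy, hxy.trans (nval_add_of_le P _ (Units.mk0 a ha0) w (hw.trans (add_comm _ _)) h)⟩

theorem fTilde_mul (I J : Frac (IntCl o L) L) (P : MaximalSpectrum (IntCl o L)) :
    fTilde K (I * J) P = fTilde K I P + fTilde K J P := by
  apply le_antisymm
  · refine RTilde.le_of_forall_le_mk fun γ h => ?_
    obtain ⟨α, β, rfl, hα, hβ⟩ := RTilde.exists_add_eq_of_add_le h
    obtain ⟨x, hx, hxα⟩ := (fTilde_le_iff I P α).1 hα
    obtain ⟨y, hy, hyβ⟩ := (fTilde_le_iff J P β).1 hβ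
    refine (fTilde_le_iff _ P _).2 ⟨x * y, FractionalIdeal.mul_mem_mul hx hy, ?_⟩
    rw [nval_mul, Rat.cast_add]
    exact add_le_add hxα hyβ
  · refine RTilde.le_of_forall_le_mk fun γ h => ?_
    obtain ⟨z, hz, hzγ⟩ := (fTilde_le_iff _ P γ).1 h
    obtain ⟨x, y, hx, hy, hxy⟩ := exists_mul_nval_le (K := K) I J P hz z rfl
    refine (RTilde.add_le_add' (fTilde_le_nval I P hx) (fTilde_le_nval J P hy)).trans ?_
    rw [RTilde.le_iff]
    have : ((nval K P x : ℝ) + nval K P y) ≤ γ := le_trans (by exact_mod_cast hxy) hzγ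
    rcases this.lt_or_eq with h | h
    · exact Or.inl h
    · exact Or.inr ⟨h, (max_self false).le⟩

theorem fTilde_smul (σ : Gal(L/K)) (I : Frac (IntCl o L) L) (P : MaximalSpectrum (IntCl o L)) :
    fTilde K (σ • I) (σ • P) = fTilde K I P := by
  have h : ∀ (σ : Gal(L/K)) (I : Frac (IntCl o L) L) (P : MaximalSpectrum (IntCl o L)),
      fTilde K (σ • I) (σ • P) ≤ fTilde K I P := fun σ I P => by
    refine RTilde.le_of_forall_le_mk fun α h => ?_
    obtain ⟨x, hx, hα⟩ := (fTilde_le_iff I P α).1 h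
    refine (fTilde_le_iff _ _ α).2 ⟨Units.map (σ : L →* L) x, ⟨x, hx, rfl⟩, ?_⟩
    rwa [nval_smul]
  refine (h σ I P).antisymm ?_
  have h' := h σ⁻¹ (σ • I) (σ • P)
  rwa [inv_smul_smul, inv_smul_smul] at h'

variable (K) in
/-- The value group as an additive subgroup of `ℝ`. -/
def valueAddSubgroup (P : MaximalSpectrum (IntCl o L)) : AddSubgroup ℝ where
  carrier := valueGroup K P
  add_mem' := by
    rintro _ _ ⟨x, rfl⟩ ⟨y, rfl⟩
    exact ⟨x * y, by simp [nval_mul]⟩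
  zero_mem' := ⟨1, by simp [nval_one]⟩
  neg_mem' := by
    rintro _ ⟨x, rfl⟩
    exact ⟨x⁻¹, by simp [nval_inv]⟩

/-- If the infimum of the values of `I` is not attained, then the value group is dense. -/
theorem valueClosure_eq_univ_of_not_inMax (I : Frac (IntCl o L) L)
    (P : MaximalSpectrum (IntCl o L)) (h : ¬ InMax K I P) : valueClosure K P = Set.univ := by
  have hgt : ∀ x : Lˣ, (x : L) ∈ I.1 → fReal K I P < nval K P x := fun x hx =>
    (fReal_le_nval I P hx).lt_of_ne fun he => h ⟨x, hx, he⟩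
  have hd : Dense (valueAddSubgroup K P : Set ℝ) := by
    refine AddSubgroup.dense_of_not_isolated_zero _ fun ε hε => ?_
    obtain ⟨x, hx, hxε⟩ := exists_nval_lt (K := K) I P (r := fReal K I P + ε) (by linarith)
    obtain ⟨y, hy, hyx⟩ := exists_nval_lt (K := K) I P (hgt x hx)
    have := hgt y hy
    refine ⟨nval K P x - nval K P y, (valueAddSubgroup K P).sub_mem ⟨x, rfl⟩ ⟨y, rfl⟩, ?_, ?_⟩ <;>
      linarith
  exact hd.closure_eq

theorem fTilde_mem_vTilde (I : Frac (IntCl o L) L) (P : MaximalSpectrum (IntCl o L)) :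
    fTilde K I P ∈ vTilde K P := by
  by_cases h : InMax K I P
  · obtain ⟨x, hx, he⟩ := id h
    exact Or.inl ⟨⟨x, he.symm⟩, by simp [fTilde, h]⟩
  · exact Or.inr ⟨by simp [fTilde, h], valueClosure_eq_univ_of_not_inMax I P h⟩

theorem fTilde_mem_Sb (I : Frac (IntCl o L) L) (P : MaximalSpectrum (IntCl o L)) :
    (fun q => fTilde K I (fibrePt K P q)) ∈ Sb (DecompQuot K P) (vTilde K P) := by
  have hopen : ∀ α : ℝ, IsOpen {q : DecompQuot K P | fTilde K I (fibrePt K P q) ≤ ⟨α, false⟩} := by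
    intro α
    have : {q : DecompQuot K P | fTilde K I (fibrePt K P q) ≤ ⟨α, false⟩} =
        ⋃ x : {x : Lˣ // (x : L) ∈ I.1},
          (fun q : DecompQuot K P => nval K (fibrePt K P q) x.1) ⁻¹' {r | (r : ℝ) ≤ α} := by
      ext q
      simp [fTilde_le_iff]
    rw [this]
    exact isOpen_iUnion fun x => isLocallyConstant_nval P x.1 _
  refine ⟨?_, ⟨Set.univ, isCompact_univ, fun x hx => absurd trivial hx⟩, ?_, ?_, fun q => ?_⟩
  · rw [upperSemicontinuous_iff_isOpen_preimage]
    rintro ⟨α, _ | _⟩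
    · have : (fun q : DecompQuot K P => fTilde K I (fibrePt K P q)) ⁻¹' Set.Iio ⟨α, false⟩ =
          ⋃ γ : {γ // γ < α}, {q | fTilde K I (fibrePt K P q) ≤ ⟨γ.1, false⟩} := by
        ext q
        simp [RTilde.lt_mk_false_iff]
      rw [this]
      exact isOpen_iUnion fun γ => hopen γ
    · have : (fun q : DecompQuot K P => fTilde K I (fibrePt K P q)) ⁻¹' Set.Iio ⟨α, true⟩ =
          {q | fTilde K I (fibrePt K P q) ≤ ⟨α, false⟩} := by
        ext q
        simp [RTilde.lt_mk_true_iff]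
      rw [this]
      exact hopen α
  · obtain ⟨x, hx⟩ := exists_unit_mem I
    obtain ⟨N, hN⟩ := exists_nat_abs_nval_le (K := K) P x
    refine ⟨⟨N, false⟩, ?_⟩
    rintro _ ⟨q, rfl⟩
    refine (fTilde_le_iff _ _ _).2 ⟨x, hx, ?_⟩
    exact_mod_cast (le_abs_self _).trans (hN q)
  · obtain ⟨u, hu⟩ := exists_le_nval_of_mem K I
    obtain ⟨N, hN⟩ := exists_nat_abs_nval_le (K := K) P u
    refine ⟨⟨-N, false⟩, ?_⟩
    rintro _ ⟨q, rfl⟩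
    refine RTilde.le_of_forall_le_mk fun α hα => ?_
    obtain ⟨x, hx, hxα⟩ := (fTilde_le_iff _ _ _).1 hα
    have h1 := hu x hx (fibrePt K P q)
    have h2 : (-N : ℝ) ≤ nval K (fibrePt K P q) x := by
      exact_mod_cast (abs_le.1 (hN q)).1.trans h1
    exact RTilde.mk_false_le_mk_false (h2.trans hxα)
  · have := fTilde_mem_vTilde (K := K) I (fibrePt K P q)
    rwa [vTilde_fibrePt] at this

/-- `I` is recovered from its values. -/
theorem mem_iff_forall_fTilde_le (I : Frac (IntCl o L) L) (x : Lˣ) :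
    (x : L) ∈ I.1 ↔
      ∀ P : MaximalSpectrum (IntCl o L), fTilde K I P ≤ ⟨nval K P x, false⟩ := by
  refine ⟨fun hx P => fTilde_le_nval I P hx, fun h => ?_⟩
  let J : Ideal (IntCl o L) :=
    { carrier := {s | (s : L) * x ∈ I.1}
      add_mem' := fun {a b} ha hb => by
        change ((a : L) + b) * x ∈ I.1.1
        rw [add_mul]; exact add_mem ha hb
      zero_mem' := by
        change (0 : L) * x ∈ I.1.1
        rw [zero_mul]; exact zero_mem _
      smul_mem' := fun c {a} ha => by
        change ((c : L) * a) * x ∈ I.1.1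
        rw [mul_assoc]; exact I.1.1.smul_mem c ha }
  have hJ : J = ⊤ := by
    by_contra hne
    obtain ⟨P, hP, hJP⟩ := J.exists_le_maximal hne
    obtain ⟨y, hy, hyx⟩ := (fTilde_le_iff I ⟨P, hP⟩ _).1 (h ⟨P, hP⟩)
    have hyx' : nval K ⟨P, hP⟩ y ≤ nval K ⟨P, hP⟩ x := by exact_mod_cast hyx
    obtain ⟨s, hs, hsx⟩ := exists_mul_mem_of_nval_nonneg (K := K) ⟨P, hP⟩ (x * y⁻¹)
      (by rw [nval_mul, nval_inv]; linarith)
    refine hs (hJP ?_)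
    have := I.1.1.smul_mem ⟨_, hsx⟩ hy
    change (s : L) * ((x * y⁻¹ : Lˣ) : L) * y ∈ I.1.1 at this
    rwa [mul_assoc, ← Units.val_mul, inv_mul_cancel_right] at this
  have h1 : (1 : IntCl o L) ∈ J := hJ ▸ Submodule.mem_top
  have h2 : (1 : L) * x ∈ I.1 := h1
  rwa [one_mul] at h2

theorem frac_ext_of_fTilde {I J : Frac (IntCl o L) L}
    (h : ∀ P : MaximalSpectrum (IntCl o L), fTilde K I P = fTilde K J P) : I = J := by
  refine Subtype.ext (FractionalIdeal.coeToSubmodule_injective (SetLike.ext fun x => ?_))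
  by_cases hx : x = 0
  · simp only [hx, zero_mem]
  · have hI := mem_iff_forall_fTilde_le (K := K) I (Units.mk0 x hx)
    have hJ := mem_iff_forall_fTilde_le (K := K) J (Units.mk0 x hx)
    simp only [h] at hI
    exact hI.trans hJ.symm

/-- Only finitely many primes of `o` lie below primes at which `I` has a non-zero value. -/
theorem finite_fTilde_ne_zero (I : Frac (IntCl o L) L) :
    {p : MaximalSpectrum o | ∃ P : MaximalSpectrum (IntCl o L),
      P.asIdeal.under o = p.asIdeal ∧ fTilde K I P ≠ 0}.Finite := by
  obtain ⟨x, hx⟩ := exists_unit_mem I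
  obtain ⟨u, hu⟩ := exists_le_nval_of_mem K I
  obtain ⟨c, hc, hcx⟩ := exists_baseUnit_le_nval (o := o) K x
  obtain ⟨d, hd, hdu⟩ := exists_baseUnit_le_nval (o := o) K u
  refine ((finite_maximalSpectrum_mem c hc).union (finite_maximalSpectrum_mem d hd)).subset ?_
  rintro p ⟨P, hP, hne⟩
  by_contra hmem
  rw [Set.mem_union, not_or] at hmem
  have h1 : nval K P (baseUnit K L c hc) = 0 :=
    (nval_baseUnit_eq_zero_iff P c hc).2 (by rw [hP]; exact hmem.1)
  have h2 : nval K P (baseUnit K L d hd) = 0 :=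
    (nval_baseUnit_eq_zero_iff P d hd).2 (by rw [hP]; exact hmem.2)
  have hx0 : nval K P x = 0 := abs_nonpos_iff.1 ((hcx P).trans h1.le)
  have hu0 : nval K P u = 0 := abs_nonpos_iff.1 ((hdu P).trans h2.le)
  refine hne (le_antisymm ?_ ?_)
  · have := fTilde_le_nval (K := K) I P hx
    rwa [hx0, Rat.cast_zero] at this
  · refine RTilde.le_of_forall_le_mk fun α hα => ?_
    obtain ⟨y, hy, hyα⟩ := (fTilde_le_iff _ _ _).1 hα
    have h3 := hu y hy P
    rw [hu0] at h3
    have h4 : (0 : ℝ) ≤ α := le_trans (by exact_mod_cast h3) hyα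
    exact RTilde.mk_false_le_mk_false h4

end FractionalIdeals

theorem exists_notMem_forall_dvd_mul {o : Type*} [CommRing o] [IsDedekindDomain o] (p : Ideal o)
    [p.IsMaximal] {c : o} (hc : c ≠ 0) :
    ∃ d, d ∉ p ∧ ∃ k : ℕ, ∀ t ∈ p ^ k, c ∣ d * t := by
  have hp : ¬ IsUnit p := fun h => ‹p.IsMaximal›.ne_top (Ideal.isUnit_iff.1 h)
  have hf : FiniteMultiplicity p (Ideal.span {c}) :=
    FiniteMultiplicity.of_not_isUnit hp (by simpa using hc)
  obtain ⟨a, ha, hpa⟩ := hf.exists_eq_pow_mul_and_not_dvd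
  rw [Ideal.dvd_iff_le, SetLike.not_le_iff_exists] at hpa
  obtain ⟨d, hda, hdp⟩ := hpa
  refine ⟨d, hdp, multiplicity p (Ideal.span {c}), fun t ht => Ideal.mem_span_singleton.1 ?_⟩
  rw [ha, mul_comm d]
  exact Ideal.mul_mem_mul ht hda

section Construction

variable {o K L : Type*} [CommRing o] [IsDedekindDomain o] [Fact (¬ IsField o)]
  [Field K] [Field L] [Algebra o K] [IsFractionRing o K] [Algebra K L] [Algebra o L]
  [IsScalarTower o K L] [IsGalois K L]

theorem under_isMaximal (P : MaximalSpectrum (IntCl o L)) : (P.asIdeal.under o).IsMaximal :=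
  have := P.isMaximal
  Ideal.isMaximal_comap_of_isIntegral_of_isMaximal P.asIdeal

theorem exists_pow_nval_ge (P : MaximalSpectrum (IntCl o L)) (x : Lˣ) (B : ℚ) :
    ∃ k : ℕ, ∀ q : DecompQuot K P, 0 < nval K (fibrePt K P q) x →
      B ≤ k * nval K (fibrePt K P q) x := by
  have h : ∀ r : ℚ, ∃ k : ℕ, 0 < r → B ≤ k * r := fun r => by
    by_cases hr : 0 < r
    · obtain ⟨k, hk⟩ := Archimedean.arch B hr
      exact ⟨k, fun _ => by rwa [nsmul_eq_mul] at hk⟩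
    · exact ⟨0, fun h => absurd h hr⟩
  choose k hk using h
  obtain ⟨m, hm⟩ := ((isLocallyConstant_nval (K := K) P x).range_finite.image k).bddAbove
  refine ⟨m, fun q hq => (hk _ hq).trans ?_⟩
  exact mul_le_mul_of_nonneg_right (Nat.cast_le.2 (hm ⟨_, ⟨q, rfl⟩, rfl⟩)) hq.le

/-- A compact set of points of a fibre is separated from a point by an element of the ring. -/
theorem exists_mem_forall_of_isCompact (P : MaximalSpectrum (IntCl o L)) (q₀ : DecompQuot K P)
    {C : Set (DecompQuot K P)} (hC : IsCompact C) (hq₀ : q₀ ∉ C) :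
    ∃ z : IntCl o L, z ∉ (fibrePt K P q₀).asIdeal ∧ ∀ q ∈ C, z ∈ (fibrePt K P q).asIdeal := by
  have hprime := (fibrePt K P q₀).isMaximal.isPrime
  refine hC.induction_on (p := fun C => ∃ z : IntCl o L, z ∉ (fibrePt K P q₀).asIdeal ∧
    ∀ q ∈ C, z ∈ (fibrePt K P q).asIdeal) ?_ ?_ ?_ ?_
  · exact ⟨1, fun h => hprime.ne_top ((Ideal.eq_top_iff_one _).2 h), fun q hq => hq.elim⟩
  · rintro s t hst ⟨z, hz, h⟩
    exact ⟨z, hz, fun q hq => h q (hst hq)⟩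
  · rintro s t ⟨z, hz, h⟩ ⟨w, hw, h'⟩
    refine ⟨z * w, fun hzw => (hprime.mem_or_mem hzw).elim hz hw, ?_⟩
    rintro q (hq | hq)
    · exact Ideal.mul_mem_right _ _ (h q hq)
    · exact Ideal.mul_mem_left _ _ (h' q hq)
  · intro q hq
    have hne : fibrePt K P q ≠ fibrePt K P q₀ := fun he => hq₀ (fibrePt_injective P he ▸ hq)
    have hnle : ¬ (fibrePt K P q).asIdeal ≤ (fibrePt K P q₀).asIdeal := fun hle =>
      hne (MaximalSpectrum.ext ((fibrePt K P q).isMaximal.eq_of_le hprime.ne_top hle))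
    obtain ⟨y, hy, hy₀⟩ := SetLike.not_le_iff_exists.1 hnle
    have hy0 : (y : L) ≠ 0 := fun h0 => hy₀ (by
      rw [show y = 0 from Subtype.ext h0]; exact zero_mem _)
    refine ⟨{q | y ∈ (fibrePt K P q).asIdeal}, mem_nhdsWithin_of_mem_nhds ?_, y, hy₀,
      fun q hq => hq⟩
    refine IsOpen.mem_nhds ?_ hy
    convert isLocallyConstant_nval (K := K) P (Units.mk0 (y : L) hy0) {r | 0 < r} using 1
    ext q
    exact (nval_pos_iff (K := K) (fibrePt K P q) (Units.mk0 (y : L) hy0) y rfl).symm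

/-- For `x ∈ Lˣ` there is `d ∈ o` outside the prime below `P` such that `d x` is integral at all
primes that do not lie above it. -/
theorem exists_base_forall_nval_nonneg (P : MaximalSpectrum (IntCl o L)) (x : Lˣ) :
    ∃ (d : o) (hd : d ≠ 0), d ∉ P.asIdeal.under o ∧ ∀ Q : MaximalSpectrum (IntCl o L),
      Q.asIdeal.under o ≠ P.asIdeal.under o → 0 ≤ nval K Q x + nval K Q (baseUnit K L d hd) := by
  obtain ⟨c, hc, hcx⟩ := exists_baseUnit_le_nval (o := o) K x
  have hP := under_isMaximal P
  obtain ⟨d, hdP, k, hd⟩ := exists_notMem_forall_dvd_mul (P.asIdeal.under o) hc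
  have hd0 : d ≠ 0 := fun h => hdP (h ▸ zero_mem _)
  refine ⟨d, hd0, hdP, fun Q hQ => ?_⟩
  have hQm := under_isMaximal Q
  have hnle : ¬ (P.asIdeal.under o) ^ k ≤ Q.asIdeal.under o := fun hle =>
    hQ (hP.eq_of_le hQm.ne_top (hQm.isPrime.le_of_pow_le hle)).symm
  obtain ⟨t, ht, htQ⟩ := SetLike.not_le_iff_exists.1 hnle
  have ht0 : t ≠ 0 := fun h => htQ (h ▸ zero_mem _)
  obtain ⟨s, hs⟩ := hd t ht
  have hs0 : s ≠ 0 := fun h => mul_ne_zero hd0 ht0 (by rw [hs, h, mul_zero])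
  have e : baseUnit K L d hd0 * baseUnit K L t ht0 = baseUnit K L c hc * baseUnit K L s hs0 := by
    refine Units.ext ?_
    change algebraMap o L d * algebraMap o L t = algebraMap o L c * algebraMap o L s
    rw [← map_mul, hs, map_mul]
  have e' := congrArg (nval K Q) e
  rw [nval_mul, nval_mul, (nval_baseUnit_eq_zero_iff Q t ht0).2 htQ] at e'
  have h1 := nval_baseUnit_nonneg (K := K) Q s hs0
  have h2 := (abs_le.1 (hcx Q)).1
  linarith

theorem exists_nat_bounds {P : MaximalSpectrum (IntCl o L)} {f : DecompQuot K P → RTilde}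
    (hf : f ∈ Sb (DecompQuot K P) (vTilde K P)) :
    ∃ N : ℕ, ∀ q, ⟨-N, false⟩ ≤ f q ∧ f q ≤ ⟨N, false⟩ := by
  obtain ⟨-, -, ⟨a, ha⟩, ⟨b, hb⟩, -⟩ := hf
  obtain ⟨N, hN⟩ := exists_nat_ge (max (a.fst + 1) (-b.fst))
  have h1 := (le_max_left _ _).trans hN
  have h2 := (le_max_right _ _).trans hN
  refine ⟨N, fun q => ⟨le_trans ?_ (hb ⟨q, rfl⟩), (ha ⟨q, rfl⟩).trans ?_⟩⟩
  · refine (RTilde.mk_false_le_mk_false (show (-N : ℝ) ≤ b.fst by linarith)).trans ?_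
    rw [RTilde.le_iff]
    exact Or.inr ⟨rfl, Bool.false_le _⟩
  · rw [RTilde.le_mk_false_iff]
    left; linarith

/-- The approximation lemma at a point of the fibre. -/
theorem exists_nval_eq_forall_le {P : MaximalSpectrum (IntCl o L)} {f : DecompQuot K P → RTilde}
    (hf : f ∈ Sb (DecompQuot K P) (vTilde K P)) (q₀ : DecompQuot K P) (x : Lˣ)
    (hx : f q₀ ≤ ⟨nval K (fibrePt K P q₀) x, false⟩) :
    ∃ u : Lˣ, nval K (fibrePt K P q₀) u = nval K (fibrePt K P q₀) x ∧
      (∀ q, f q ≤ ⟨nval K (fibrePt K P q) u, false⟩) ∧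
      ∀ Q : MaximalSpectrum (IntCl o L), Q.asIdeal.under o ≠ P.asIdeal.under o →
        0 ≤ nval K Q u := by
  obtain ⟨N, hN⟩ := exists_nat_bounds hf
  set α := nval K (fibrePt K P q₀) x with hα
  let U : Set (DecompQuot K P) :=
    {q | f q < ⟨α, true⟩} ∩ (fun q => nval K (fibrePt K P q) x) ⁻¹' {α}
  have hU : IsOpen U :=
    ((upperSemicontinuous_iff_isOpen_preimage.1 hf.1) _).inter (isLocallyConstant_nval P x _)
  obtain ⟨z, hz₀, hz⟩ := exists_mem_forall_of_isCompact P q₀ (C := Uᶜ)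
    hU.isClosed_compl.isCompact (fun h => h ⟨RTilde.lt_mk_true_iff.2 hx, rfl⟩)
  have hz0 : (z : L) ≠ 0 := fun h0 => hz₀ (by
    rw [show z = 0 from Subtype.ext h0]; exact zero_mem _)
  let z' := Units.mk0 (z : L) hz0
  have hzn : ∀ Q : MaximalSpectrum (IntCl o L), 0 ≤ nval K Q z' := fun Q =>
    nval_nonneg_of_mem Q z' z.2
  obtain ⟨M, hM⟩ := exists_nat_abs_nval_le (K := K) P x
  obtain ⟨k, hk⟩ := exists_pow_nval_ge (K := K) P z' (N + M)
  obtain ⟨d, hd0, hdP, hd⟩ := exists_base_forall_nval_nonneg (K := K) P x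
  have hdn : ∀ Q : MaximalSpectrum (IntCl o L), 0 ≤ nval K Q (baseUnit K L d hd0) := fun Q =>
    nval_baseUnit_nonneg Q d hd0
  have hval : ∀ Q : MaximalSpectrum (IntCl o L), nval K Q (z' ^ k * (x * baseUnit K L d hd0)) =
      k * nval K Q z' + (nval K Q x + nval K Q (baseUnit K L d hd0)) := fun Q => by
    rw [nval_mul, nval_mul, nval_pow]
  have hkn : ∀ Q : MaximalSpectrum (IntCl o L), 0 ≤ k * nval K Q z' := fun Q =>
    mul_nonneg (Nat.cast_nonneg k) (hzn Q)
  refine ⟨z' ^ k * (x * baseUnit K L d hd0), ?_, fun q => ?_, fun Q hQ => ?_⟩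
  · rw [hval, (nval_eq_zero_iff _ z' z rfl).2 hz₀,
      (nval_baseUnit_eq_zero_iff _ d hd0).2 (by rwa [under_fibrePt])]
    ring
  · by_cases hq : q ∈ U
    · refine (RTilde.lt_mk_true_iff.1 hq.1).trans (RTilde.mk_false_le_mk_false ?_)
      have h1 : nval K (fibrePt K P q) x = α := hq.2
      have h2 := hkn (fibrePt K P q)
      have h3 := hdn (fibrePt K P q)
      have h4 : α ≤ nval K (fibrePt K P q) (z' ^ k * (x * baseUnit K L d hd0)) := by
        rw [hval, h1]; linarith
      exact_mod_cast h4
    · refine (hN q).2.trans (RTilde.mk_false_le_mk_false ?_)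
      have h1 := hk q ((nval_pos_iff _ z' z rfl).2 (hz q hq))
      have h2 := (abs_le.1 (hM q)).1
      have h3 := hdn (fibrePt K P q)
      have h4 : (N : ℚ) ≤ nval K (fibrePt K P q) (z' ^ k * (x * baseUnit K L d hd0)) := by
        rw [hval]; linarith
      exact_mod_cast h4
  · rw [hval]
    exact add_nonneg (hkn Q) (hd Q hQ)

theorem exists_baseUnit_forall_le {P : MaximalSpectrum (IntCl o L)} (N : ℕ)
    (d : o) (hd : d ∈ P.asIdeal.under o) (hd0 : d ≠ 0) :
    ∃ k : ℕ, ∀ q : DecompQuot K P,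
      (N : ℚ) ≤ nval K (fibrePt K P q) (baseUnit K L d hd0 ^ k) := by
  obtain ⟨k, hk⟩ := exists_pow_nval_ge (K := K) P (baseUnit K L d hd0) N
  refine ⟨k, fun q => ?_⟩
  rw [nval_pow]
  exact hk q ((nval_baseUnit_pos_iff _ d hd0).2 (by rwa [under_fibrePt]))

variable (K) in
/-- The elements of `L` with values at least `F`. -/
def valuesGe (F : MaximalSpectrum (IntCl o L) → RTilde) : Submodule (IntCl o L) L where
  carrier := {x | ∀ u : Lˣ, (u : L) = x → ∀ Q, F Q ≤ ⟨nval K Q u, false⟩}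
  zero_mem' := fun u hu => absurd hu u.ne_zero
  add_mem' := by
    intro a b ha hb w hw Q
    by_cases ha0 : a = 0
    · exact hb w (by rw [hw, ha0, zero_add]) Q
    by_cases hb0 : b = 0
    · exact ha w (by rw [hw, hb0, add_zero]) Q
    rcases le_total (nval K Q (Units.mk0 a ha0)) (nval K Q (Units.mk0 b hb0)) with h | h
    · refine (ha (Units.mk0 a ha0) rfl Q).trans (RTilde.mk_false_le_mk_false ?_)
      exact_mod_cast nval_add_of_le Q _ (Units.mk0 b hb0) w hw h
    · refine (hb (Units.mk0 b hb0) rfl Q).trans (RTilde.mk_false_le_mk_false ?_)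
      exact_mod_cast nval_add_of_le Q _ (Units.mk0 a ha0) w (hw.trans (add_comm _ _)) h
  smul_mem' := by
    intro c x hx w hw Q
    have hcx : (c : L) * x ≠ 0 := fun h => w.ne_zero (hw.trans h)
    have hw' : w = Units.mk0 (c : L) (left_ne_zero_of_mul hcx) *
        Units.mk0 x (right_ne_zero_of_mul hcx) := Units.ext hw
    refine (hx (Units.mk0 x (right_ne_zero_of_mul hcx)) rfl Q).trans
      (RTilde.mk_false_le_mk_false ?_)
    rw [hw', nval_mul]
    have := nval_nonneg_of_mem (K := K) Q (Units.mk0 (c : L) (left_ne_zero_of_mul hcx)) c.2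
    exact_mod_cast le_add_of_nonneg_left this

/-- A function with prescribed values in one fibre, and the value `0` elsewhere, comes from a
fractional ideal. -/
theorem exists_frac_fTilde_eq (P : MaximalSpectrum (IntCl o L)) {f : DecompQuot K P → RTilde}
    (hf : f ∈ Sb (DecompQuot K P) (vTilde K P)) :
    ∃ I : Frac (IntCl o L) L, (∀ q, fTilde K I (fibrePt K P q) = f q) ∧
      ∀ Q : MaximalSpectrum (IntCl o L), Q.asIdeal.under o ≠ P.asIdeal.under o →
        fTilde K I Q = 0 := by
  classical
  let F : MaximalSpectrum (IntCl o L) → RTilde := fun Q =>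
    if h : ∃ q, fibrePt K P q = Q then f h.choose else 0
  have hF : ∀ q, F (fibrePt K P q) = f q := fun q => by
    have h : ∃ q', fibrePt K P q' = fibrePt K P q := ⟨q, rfl⟩
    change (if h : _ then _ else _) = _
    rw [dif_pos h, fibrePt_injective P h.choose_spec]
  have hF0 : ∀ Q : MaximalSpectrum (IntCl o L), Q.asIdeal.under o ≠ P.asIdeal.under o →
      F Q = 0 := fun Q hQ => by
    refine dif_neg ?_
    rintro ⟨q, rfl⟩
    exact hQ (under_fibrePt P q)
  have hcase : ∀ Q : MaximalSpectrum (IntCl o L), (∃ q, fibrePt K P q = Q) ∨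
      Q.asIdeal.under o ≠ P.asIdeal.under o := fun Q => by
    by_cases h : Q.asIdeal.under o = P.asIdeal.under o
    · exact Or.inl (exists_fibrePt_eq P Q h.symm)
    · exact Or.inr h
  have hmem : ∀ u : Lˣ, (∀ q, f q ≤ ⟨nval K (fibrePt K P q) u, false⟩) →
      (∀ Q : MaximalSpectrum (IntCl o L), Q.asIdeal.under o ≠ P.asIdeal.under o →
        0 ≤ nval K Q u) → (u : L) ∈ valuesGe K F := by
    intro u h1 h2 w hw Q
    rw [Units.ext hw]
    rcases hcase Q with ⟨q, rfl⟩ | hQ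
    · rw [hF]; exact h1 q
    · rw [hF0 Q hQ]
      exact RTilde.mk_false_le_mk_false (by exact_mod_cast h2 Q hQ)
  obtain ⟨N, hN⟩ := exists_nat_bounds hf
  have hPm := under_isMaximal P
  have hPbot : P.asIdeal.under o ≠ ⊥ := Ring.ne_bot_of_isMaximal_of_not_isField hPm Fact.out
  have hbase : ∀ d ∈ P.asIdeal.under o, d ≠ 0 → ∃ (k : ℕ) (hdk : d ^ k ≠ 0),
      (∀ q, (N : ℚ) ≤ nval K (fibrePt K P q) (baseUnit K L (d ^ k) hdk)) ∧
      ((baseUnit K L (d ^ k) hdk : Lˣ) : L) ∈ valuesGe K F := by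
    intro d hd hd0
    obtain ⟨k, hk⟩ := exists_baseUnit_forall_le (K := K) (L := L) N d hd hd0
    have e : baseUnit K L (d ^ k) (pow_ne_zero k hd0) = baseUnit K L d hd0 ^ k :=
      Units.ext (by rw [Units.val_pow_eq_pow_val]; exact map_pow _ _ _)
    rw [← e] at hk
    refine ⟨k, pow_ne_zero k hd0, hk, hmem _ (fun q => ?_) fun Q _ => nval_baseUnit_nonneg Q _ _⟩
    exact (hN q).2.trans (RTilde.mk_false_le_mk_false (by exact_mod_cast hk q))
  obtain ⟨c, hc, hc0⟩ := Submodule.exists_mem_ne_zero_of_ne_bot hPbot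
  obtain ⟨k, hck, hk, hkmem⟩ := hbase c hc hc0
  have hfrac : IsFractional (IntCl o L)⁰ (valuesGe K F) := by
    refine ⟨algebraMap o (IntCl o L) (c ^ k), ?_, fun x hx => ?_⟩
    · rw [mem_nonZeroDivisors_iff_ne_zero]
      exact fun h => (baseUnit K L (c ^ k) hck).ne_zero (congrArg Subtype.val h)
    · by_cases hx0 : x = 0
      · exact ⟨0, by rw [hx0, smul_zero, map_zero]⟩
      have hint := mem_of_forall_nval_nonneg (o := o) (K := K)
        (baseUnit K L (c ^ k) hck * Units.mk0 x hx0) (fun Q => by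
          rw [nval_mul]
          have hxQ := hx (Units.mk0 x hx0) rfl Q
          rcases hcase Q with ⟨q, rfl⟩ | hQ
          · rw [hF] at hxQ
            have h1 := (hN q).1.trans hxQ
            have h2 : (-N : ℝ) ≤ nval K (fibrePt K P q) (Units.mk0 x hx0) :=
              RTilde.fst_le_of_le_mk h1
            have h3 : (-N : ℚ) ≤ nval K (fibrePt K P q) (Units.mk0 x hx0) := by
              exact_mod_cast h2
            linarith [hk q]
          · rw [hF0 Q hQ] at hxQ
            have h2 : (0 : ℝ) ≤ nval K Q (Units.mk0 x hx0) :=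
              RTilde.fst_le_of_le_mk hxQ
            exact add_nonneg (nval_baseUnit_nonneg Q _ _) (by exact_mod_cast h2))
      exact ⟨⟨_, hint⟩, rfl⟩
  let I : Frac (IntCl o L) L := ⟨⟨valuesGe K F, hfrac⟩, fun h => by
    refine (baseUnit K L (c ^ k) hck).ne_zero (FractionalIdeal.eq_zero_iff.1 h _ hkmem)⟩
  have hI : ∀ Q, fTilde K I Q = F Q := fun Q => by
    apply le_antisymm
    · refine RTilde.le_of_forall_le_mk fun α hα => (fTilde_le_iff I Q α).2 ?_
      rcases hcase Q with ⟨q, rfl⟩ | hQ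
      · rw [hF] at hα
        obtain ⟨x, hx, hxα⟩ : ∃ x : Lˣ, f q ≤ ⟨nval K (fibrePt K P q) x, false⟩ ∧
            (nval K (fibrePt K P q) x : ℝ) ≤ α := by
          have hv := hf.2.2.2.2 q
          rw [← vTilde_fibrePt P q] at hv
          rcases hv with ⟨⟨x, hx⟩, hs⟩ | ⟨hs, hd⟩
          · refine ⟨x, le_of_eq (RTilde.ext hx.symm hs), ?_⟩
            exact hx.le.trans (RTilde.fst_le_of_le_mk hα)
          · have hlt : (f q).fst < α := by
              rcases RTilde.le_mk_false_iff.1 hα with h | h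
              · exact h
              · rw [hs] at h; cases h.2
            obtain ⟨_, ⟨x, rfl⟩, h1, h2⟩ :=
              (dense_iff_closure_eq.2 hd).exists_between hlt
            exact ⟨x, RTilde.le_mk_false_iff.2 (Or.inl h1), h2.le⟩
        obtain ⟨u, hu, h1, h2⟩ := exists_nval_eq_forall_le hf q x hx
        exact ⟨u, hmem u h1 h2, by rw [hu]; exact hxα⟩
      · rw [hF0 Q hQ] at hα
        have hQm := under_isMaximal Q
        obtain ⟨d, hd, hdQ⟩ := SetLike.not_le_iff_exists.1 fun hle : P.asIdeal.under o ≤ _ =>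
          hQ (hPm.eq_of_le hQm.ne_top hle).symm
        obtain ⟨j, hdj, -, hdmem⟩ := hbase d hd fun h => hdQ (h ▸ zero_mem _)
        refine ⟨_, hdmem, ?_⟩
        rw [(nval_baseUnit_eq_zero_iff Q _ hdj).2
          fun h => hdQ (hQm.isPrime.mem_of_pow_mem _ h), Rat.cast_zero]
        exact RTilde.fst_le_of_le_mk hα
    · refine RTilde.le_of_forall_le_mk fun α hα => ?_
      obtain ⟨x, hx, hxα⟩ := (fTilde_le_iff I Q α).1 hα
      exact (hx x rfl Q).trans (RTilde.mk_false_le_mk_false hxα)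
  exact ⟨I, fun q => (hI _).trans (hF q), fun Q hQ => (hI Q).trans (hF0 Q hQ)⟩

end Construction

section FibreFunctions

variable {o K L : Type*} [CommRing o] [IsDedekindDomain o] [Fact (¬ IsField o)]
  [Field K] [Field L] [Algebra o K] [IsFractionRing o K] [Algebra K L] [Algebra o L]
  [IsScalarTower o K L] [IsGalois K L]

theorem fTilde_one (P : MaximalSpectrum (IntCl o L)) :
    fTilde K (1 : Frac (IntCl o L) L) P = 0 := by
  apply le_antisymm
  · have h1 : ((1 : Lˣ) : L) ∈ (1 : Frac (IntCl o L) L).1 :=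
      FractionalIdeal.one_mem_one (IntCl o L)⁰
    have := fTilde_le_nval (K := K) 1 P h1
    rwa [nval_one, Rat.cast_zero] at this
  · refine RTilde.le_of_forall_le_mk fun α hα => ?_
    obtain ⟨x, hx, hxα⟩ := (fTilde_le_iff _ _ _).1 hα
    obtain ⟨a, ha⟩ := (FractionalIdeal.mem_one_iff (IntCl o L)⁰).1 hx
    have h := nval_nonneg_of_mem (K := K) P x (by rw [← ha]; exact a.2)
    exact RTilde.mk_false_le_mk_false (le_trans (by exact_mod_cast h) hxα)

variable (K) in
/-- The function `σ D_P ↦ f̃_I(σ(P))`, as a homomorphism in `I`. -/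
def fibreHom (P : MaximalSpectrum (IntCl o L)) :
    Frac (IntCl o L) L →* Multiplicative (Sb (DecompQuot K P) (vTilde K P)) where
  toFun I := Multiplicative.ofAdd ⟨fun q => fTilde K I (fibrePt K P q), fTilde_mem_Sb I P⟩
  map_one' := congrArg Multiplicative.ofAdd (Subtype.ext (funext fun _ => fTilde_one _))
  map_mul' I J := congrArg Multiplicative.ofAdd (Subtype.ext (funext fun _ => fTilde_mul I J _))

variable (K) in
/-- The function `σ D_P ↦ f̃_I(σ(P))`. -/
def fibreFun (I : Frac (IntCl o L) L) (P : MaximalSpectrum (IntCl o L)) :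
    Sb (DecompQuot K P) (vTilde K P) := (fibreHom K P I).toAdd

theorem fibreFun_mul (I J : Frac (IntCl o L) L) (P : MaximalSpectrum (IntCl o L)) :
    fibreFun K (I * J) P = fibreFun K I P + fibreFun K J P :=
  congrArg Multiplicative.toAdd (map_mul (fibreHom K P) I J)

theorem fibreFun_one (P : MaximalSpectrum (IntCl o L)) :
    fibreFun K (1 : Frac (IntCl o L) L) P = 0 :=
  congrArg Multiplicative.toAdd (map_one (fibreHom K P))

theorem fibreFun_smul (σ : Gal(L/K)) (I : Frac (IntCl o L) L) (P : MaximalSpectrum (IntCl o L)) :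
    fibreFun K (σ • I) P = σ • fibreFun K I P := by
  refine Subtype.ext (funext fun q => ?_)
  change fTilde K (σ • I) (fibrePt K P q) = fTilde K I (fibrePt K P (σ⁻¹ • q))
  rw [fibrePt_smul, ← fTilde_smul σ I, smul_inv_smul]

variable {pL : MaximalSpectrum o → MaximalSpectrum (IntCl o L)}

section Family

variable (hpL : ∀ p, (pL p).asIdeal.LiesOver p.asIdeal)
include hpL

theorem frac_ext_of_fibreFun {I J : Frac (IntCl o L) L}
    (h : ∀ p, fibreFun K I (pL p) = fibreFun K J (pL p)) : I = J := by
  refine frac_ext_of_fTilde (K := K) fun Q => ?_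
  obtain ⟨q, hq⟩ := exists_fibrePt_eq (K := K) (pL ⟨Q.asIdeal.under o, under_isMaximal Q⟩) Q
    (hpL ⟨_, under_isMaximal Q⟩).over.symm
  rw [← hq]
  exact congrFun (congrArg Subtype.val (h _)) q

theorem finite_fibreFun_ne_zero (I : Frac (IntCl o L) L) :
    {p | fibreFun K I (pL p) ≠ 0}.Finite := by
  refine (finite_fTilde_ne_zero (K := K) I).subset fun p hp => ?_
  by_contra hne
  refine hp (Subtype.ext (funext fun q => ?_))
  by_contra hq
  exact hne ⟨fibrePt K (pL p) q, by rw [under_fibrePt]; exact (hpL p).over.symm, hq⟩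

theorem exists_fibreFun_eq (g : ∀ p, Sb (DecompQuot K (pL p)) (vTilde K (pL p)))
    (hg : {p | g p ≠ 0}.Finite) :
    ∃ I : Frac (IntCl o L) L, ∀ p, fibreFun K I (pL p) = g p := by
  have h : ∀ p, ∃ I : Frac (IntCl o L) L, fibreFun K I (pL p) = g p ∧
      ∀ p', p' ≠ p → fibreFun K I (pL p') = 0 := fun p => by
    obtain ⟨I, h1, h2⟩ := exists_frac_fTilde_eq (pL p) (g p).2
    refine ⟨I, Subtype.ext (funext h1), fun p' hp' => Subtype.ext (funext fun q => h2 _ ?_)⟩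
    rw [under_fibrePt, ← (hpL p).over, ← (hpL p').over]
    exact fun h => hp' (MaximalSpectrum.ext h)
  choose I h1 h2 using h
  refine ⟨∏ p ∈ hg.toFinset, I p, fun p => ?_⟩
  have e := map_prod (fibreHom K (pL p)) I hg.toFinset
  refine (congrArg Multiplicative.toAdd e).trans ?_
  rw [Finset.prod_eq_single p]
  · exact h1 p
  · exact fun p' _ hp' => congrArg Multiplicative.ofAdd (h2 p' p hp'.symm)
  · intro hp
    have : g p = 0 := by simpa using hp
    exact congrArg Multiplicative.ofAdd ((h1 p).trans this)

end Family

end FibreFunctions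

section Reflexible

variable {X : Type*} [TopologicalSpace X] {V W : AddSubmonoid RTilde}

theorem Sb_mono (h : W ≤ V) : Sb X W ≤ Sb X V :=
  fun _ hf => ⟨hf.1, hf.2.1, hf.2.2.1, hf.2.2.2.1, fun x => h (hf.2.2.2.2 x)⟩

theorem mem_Sb_of_forall_mem {f : X → RTilde} (hf : f ∈ Sb X V) (h : ∀ x, f x ∈ W) : f ∈ Sb X W :=
  ⟨hf.1, hf.2.1, hf.2.2.1, hf.2.2.2.1, h⟩

theorem add_iota_add_self (f : X → RTilde) : f + RTilde.iota ∘ f + f = f := by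
  funext x
  refine RTilde.ext ?_ ?_
  · change (f x).fst + -(f x).fst + (f x).fst = (f x).fst
    ring
  · change max (max (f x).snd (f x).snd) (f x).snd = (f x).snd
    rw [max_self, max_self]

/-- A function that is regular in `S(X; V)` is reflexible. -/
theorem mem_SrefIn_of_eq_add {f g : Sb X V} (h : f = f + g + f) : f ∈ SrefIn X V V := by
  refine ⟨f.2, ?_⟩
  have he : RTilde.iota ∘ f.1 = (g + f + g).1 := by
    funext x
    have hx : f.1 x = f.1 x + g.1 x + f.1 x := congrFun (congrArg Subtype.val h) x
    have h1 := congrArg RTilde.fst hx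
    have h2 := congrArg RTilde.snd hx
    simp only [RTilde.add_fst, RTilde.add_snd] at h1 h2
    refine RTilde.ext ?_ ?_
    · change -(f.1 x).fst = (g.1 x).fst + (f.1 x).fst + (g.1 x).fst
      linarith
    · change (f.1 x).snd = max (max (g.1 x).snd (f.1 x).snd) (g.1 x).snd
      revert h2
      generalize (f.1 x).snd = s, (g.1 x).snd = t
      revert s t
      decide
  change RTilde.iota ∘ f.1 ∈ Sb X V
  rw [he]
  exact (g + f + g).2

/-- A unit of `S(X; V)` is reflexible, with values in the elements `(α, 0)` of `V`. -/
theorem mem_SrefIn_of_add_eq_zero (hVW : ∀ a ∈ V, a.snd = false → a ∈ W) {f g : Sb X V}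
    (h : f + g = 0) : f ∈ SrefIn X V W := by
  have hx : ∀ x, f.1 x + g.1 x = 0 := fun x => congrFun (congrArg Subtype.val h) x
  have hs : ∀ x, (f.1 x).snd = false ∧ (g.1 x).snd = false := fun x =>
    (by decide : ∀ s t : Bool, max s t = false → s = false ∧ t = false) _ _
      (congrArg RTilde.snd (hx x))
  have he : RTilde.iota ∘ f.1 = g.1 := by
    funext x
    have h1 := congrArg RTilde.fst (hx x)
    refine RTilde.ext ?_ ((hs x).1.trans (hs x).2.symm)
    change -(f.1 x).fst = (g.1 x).fst
    rw [RTilde.add_fst, RTilde.zero_fst] at h1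
    linarith
  refine ⟨mem_Sb_of_forall_mem f.2 fun x => hVW _ (f.2.2.2.2.2 x) (hs x).1, ?_⟩
  change RTilde.iota ∘ f.1 ∈ Sb X W
  rw [he]
  exact mem_Sb_of_forall_mem g.2 fun x => hVW _ (g.2.2.2.2.2 x) (hs x).2

/-- Elements of a quotient monoid have representatives such that zero is represented by zero. -/
theorem exists_rep_eq_zero {M : Type*} [AddCommMonoid M] {N N' : AddSubmonoid M}
    {y : AddQuot N} (hy : y ∈ N'.map (AddQuot.mk N)) :
    ∃ g ∈ N', AddQuot.mk N g = y ∧ (y = 0 → g = 0) := by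
  by_cases h : y = 0
  · exact ⟨0, N'.zero_mem, by rw [h, map_zero], fun _ => rfl⟩
  · obtain ⟨g, hg, rfl⟩ := hy
    exact ⟨g, hg, rfl, fun h' => absurd h' h⟩

end Reflexible

section Isomorphism

variable {o K L : Type*} [CommRing o] [IsDedekindDomain o] [Fact (¬ IsField o)]
  [Field K] [Field L] [Algebra o K] [IsFractionRing o K] [Algebra K L] [Algebra o L]
  [IsScalarTower o K L] [IsGalois K L]
  {pL : MaximalSpectrum o → MaximalSpectrum (IntCl o L)}

theorem valSub_le_vTilde (P : MaximalSpectrum (IntCl o L)) : valSub K P ≤ vTilde K P :=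
  fun _ => Or.inl

theorem mem_valSub_of_snd {P : MaximalSpectrum (IntCl o L)} :
    ∀ a ∈ vTilde K P, a.snd = false → a ∈ valSub K P := by
  rintro a (h | ⟨h, -⟩) hs
  · exact h
  · rw [h] at hs; cases hs

/-- `Ṽ_P = val_P` if the value group at `P` is closed: it consists of rational numbers, so it is not `ℝ`. -/
theorem vTilde_eq_valSub {P : MaximalSpectrum (IntCl o L)}
    (h : valueGroup K P = valueClosure K P) : vTilde K P = valSub K P := by
  refine le_antisymm ?_ (valSub_le_vTilde P)
  rintro a (ha | ⟨-, hu⟩)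
  · exact ha
  · obtain ⟨x, hx⟩ : √2 ∈ valueGroup K P := by rw [h, hu]; trivial
    exact absurd ⟨_, hx⟩ irrational_sqrt_two

variable (hpL : ∀ p, (pL p).asIdeal.LiesOver p.asIdeal)
include hpL

/-- A fractional ideal whose fibre functions are those of `I`, composed with the involution. -/
theorem exists_fibreFun_eq_iota {I : Frac (IntCl o L) L}
    (h : ∀ p, RTilde.iota ∘ (fibreFun K I (pL p)).1 ∈
      Sb (DecompQuot K (pL p)) (vTilde K (pL p))) :
    ∃ J : Frac (IntCl o L) L, ∀ p,
      (fibreFun K J (pL p)).1 = RTilde.iota ∘ (fibreFun K I (pL p)).1 := by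
  obtain ⟨J, hJ⟩ := exists_fibreFun_eq (K := K) hpL
    (fun p => ⟨RTilde.iota ∘ (fibreFun K I (pL p)).1, h p⟩)
    ((finite_fibreFun_ne_zero (K := K) hpL I).subset fun p hp h0 => hp (by
      refine Subtype.ext (funext fun q => ?_)
      change RTilde.iota ((fibreFun K I (pL p)).1 q) = 0
      rw [h0]
      exact RTilde.iota_zero))
  exact ⟨J, fun p => congrArg Subtype.val (hJ p)⟩

theorem mem_invFrac_iff (I : Frac (IntCl o L) L) : I ∈ InvFrac (IntCl o L) L ↔
    ∀ p, fibreFun K I (pL p) ∈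
      SrefIn (DecompQuot K (pL p)) (vTilde K (pL p)) (valSub K (pL p)) := by
  constructor
  · intro hI p
    obtain ⟨J, hJ⟩ := isUnit_iff_exists_inv.1 hI
    refine mem_SrefIn_of_add_eq_zero mem_valSub_of_snd (g := fibreFun K J (pL p)) ?_
    rw [← fibreFun_mul, hJ, fibreFun_one]
  · intro h
    obtain ⟨J, hJ⟩ := exists_fibreFun_eq_iota hpL fun p => Sb_mono (valSub_le_vTilde _) (h p).2
    refine isUnit_iff_exists_inv.2 ⟨J, frac_ext_of_fibreFun (K := K) hpL fun p => ?_⟩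
    rw [fibreFun_mul, fibreFun_one]
    refine Subtype.ext (funext fun q => ?_)
    change (fibreFun K I (pL p)).1 q + (fibreFun K J (pL p)).1 q = 0
    rw [hJ]
    exact RTilde.add_iota_self ((h p).1.2.2.2.2 q).2

theorem mem_reg_frac_iff (I : Frac (IntCl o L) L) : I ∈ Reg (Frac (IntCl o L) L) ↔
    ∀ p, fibreFun K I (pL p) ∈
      SrefIn (DecompQuot K (pL p)) (vTilde K (pL p)) (vTilde K (pL p)) := by
  constructor
  · rintro ⟨J, hJ⟩ p
    refine mem_SrefIn_of_eq_add (g := fibreFun K J (pL p)) ?_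
    rw [← fibreFun_mul, ← fibreFun_mul, ← hJ]
  · intro h
    obtain ⟨J, hJ⟩ := exists_fibreFun_eq_iota hpL fun p => (h p).2
    refine ⟨J, frac_ext_of_fibreFun (K := K) hpL fun p => ?_⟩
    rw [fibreFun_mul, fibreFun_mul]
    refine Subtype.ext ?_
    change _ = (fibreFun K I (pL p)).1 + (fibreFun K J (pL p)).1 + (fibreFun K I (pL p)).1
    rw [hJ, add_iota_add_self]

variable (K) in
/-- The family of the classes of the fibre functions of a fractional ideal. -/
def classFamily (I : Frac (IntCl o L) L) : ⨁ p : MaximalSpectrum o, LocalM K (pL p) :=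
  ⟨fun p => AddQuot.mk _ (fibreFun K I (pL p)),
    Trunc.mk ⟨(finite_fibreFun_ne_zero (K := K) hpL I).toFinset.val, fun p => by
      by_cases h : fibreFun K I (pL p) = 0
      · right; rw [h, map_zero]
      · left; simpa using h⟩⟩

variable (K) in
/-- `classFamily` as a homomorphism. -/
def classFamilyHom : Frac (IntCl o L) L →*
    Multiplicative (⨁ p : MaximalSpectrum o, LocalM K (pL p)) where
  toFun I := Multiplicative.ofAdd (classFamily K hpL I)
  map_one' := by
    refine congrArg Multiplicative.ofAdd (DFinsupp.ext fun p => ?_)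
    change AddQuot.mk _ (fibreFun K 1 (pL p)) = 0
    rw [fibreFun_one, map_zero]
  map_mul' I J := by
    refine congrArg Multiplicative.ofAdd (DFinsupp.ext fun p => ?_)
    change AddQuot.mk _ (fibreFun K (I * J) (pL p)) =
      AddQuot.mk _ (fibreFun K I (pL p)) + AddQuot.mk _ (fibreFun K J (pL p))
    rw [fibreFun_mul, map_add]

theorem exists_classFamily_eq (N : ∀ p, AddSubmonoid (Sb (DecompQuot K (pL p)) (vTilde K (pL p))))
    (y : ⨁ p : MaximalSpectrum o, LocalM K (pL p)) (hy : ∀ p, y p ∈ (N p).map (AddQuot.mk _)) :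
    ∃ I : Frac (IntCl o L) L, classFamily K hpL I = y ∧ ∀ p, fibreFun K I (pL p) ∈ N p := by
  choose g hgN hgy hg0 using fun p => exists_rep_eq_zero (hy p)
  obtain ⟨I, hI⟩ := exists_fibreFun_eq (K := K) hpL g
    ((DFinsupp.finite_support y).subset fun p hp h0 => hp (hg0 p h0))
  refine ⟨I, DFinsupp.ext fun p => ?_, fun p => by rw [hI]; exact hgN p⟩
  change AddQuot.mk _ (fibreFun K I (pL p)) = y p
  rw [hI, hgy]

theorem classFamily_eq_iff (I J : Frac (IntCl o L) L) :
    classFamily K hpL I = classFamily K hpL J ↔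
      ∃ A ∈ InvFrac (IntCl o L) L, ∃ B ∈ InvFrac (IntCl o L) L, I * A = J * B := by
  constructor
  · intro h
    have h' : ∀ p, ∃ a ∈ SrefIn (DecompQuot K (pL p)) (vTilde K (pL p)) (valSub K (pL p)),
        ∃ b ∈ SrefIn (DecompQuot K (pL p)) (vTilde K (pL p)) (valSub K (pL p)),
          fibreFun K I (pL p) + a = fibreFun K J (pL p) + b ∧
          (fibreFun K I (pL p) = 0 → fibreFun K J (pL p) = 0 → a = 0 ∧ b = 0) := fun p => by
      by_cases h0 : fibreFun K I (pL p) = 0 ∧ fibreFun K J (pL p) = 0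
      · exact ⟨0, zero_mem _, 0, zero_mem _, by rw [h0.1, h0.2], fun _ _ => ⟨rfl, rfl⟩⟩
      · obtain ⟨a, ha, b, hb, hab⟩ := (AddCon.eq _).1 (DFunLike.congr_fun h p)
        exact ⟨a, ha, b, hb, hab, fun h1 h2 => absurd ⟨h1, h2⟩ h0⟩
    choose a ha b hb hab h0 using h'
    have hfin := (finite_fibreFun_ne_zero (K := K) hpL I).union
      (finite_fibreFun_ne_zero (K := K) hpL J)
    have hsub : ∀ p, p ∉ {p | fibreFun K I (pL p) ≠ 0} ∪ {p | fibreFun K J (pL p) ≠ 0} →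
        a p = 0 ∧ b p = 0 := fun p hp => by
      rw [Set.mem_union, not_or] at hp
      exact h0 p (not_not.1 hp.1) (not_not.1 hp.2)
    obtain ⟨A, hA⟩ := exists_fibreFun_eq (K := K) hpL a
      (hfin.subset fun p hp => by_contra fun hn => hp (hsub p hn).1)
    obtain ⟨B, hB⟩ := exists_fibreFun_eq (K := K) hpL b
      (hfin.subset fun p hp => by_contra fun hn => hp (hsub p hn).2)
    refine ⟨A, (mem_invFrac_iff (K := K) hpL A).2 fun p => by rw [hA]; exact ha p,
      B, (mem_invFrac_iff (K := K) hpL B).2 fun p => by rw [hB]; exact hb p,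
      frac_ext_of_fibreFun (K := K) hpL fun p => ?_⟩
    rw [fibreFun_mul, fibreFun_mul, hA, hB, hab]
  · rintro ⟨A, hA, B, hB, h⟩
    refine DFinsupp.ext fun p => (AddCon.eq _).2
      ⟨fibreFun K A (pL p), (mem_invFrac_iff (K := K) hpL A).1 hA p,
        fibreFun K B (pL p), (mem_invFrac_iff (K := K) hpL B).1 hB p, ?_⟩
    rw [← fibreFun_mul, ← fibreFun_mul, h]

omit hpL in
theorem princ_le_invFrac (R F : Type*) [CommRing R] [IsDomain R] [Field F] [Algebra R F]
    [IsFractionRing R F] : Princ R F ≤ InvFrac R F := by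
  rintro I ⟨a, ha⟩
  have hspan : I.1 = FractionalIdeal.spanSingleton R⁰ (a : F) :=
    FractionalIdeal.coeToSubmodule_injective
      (ha.trans (FractionalIdeal.coe_spanSingleton R⁰ (a : F)).symm)
  refine isUnit_iff_exists_inv.2 ⟨⟨FractionalIdeal.spanSingleton R⁰ ((a⁻¹ : Fˣ) : F),
    FractionalIdeal.spanSingleton_ne_zero_iff.2 (Units.ne_zero _)⟩, Subtype.ext ?_⟩
  change I.1 * FractionalIdeal.spanSingleton R⁰ ((a⁻¹ : Fˣ) : F) = 1
  rw [hspan, FractionalIdeal.spanSingleton_mul_spanSingleton, Units.mul_inv,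
    FractionalIdeal.spanSingleton_one]

omit hpL in
/-- Two fractional ideals have the same class modulo the Picard group if and only if they differ
by invertible ideals. -/
theorem mk_mk_eq_iff {R F : Type*} [CommRing R] [IsDomain R] [Field F] [Algebra R F]
    [IsFractionRing R F] (I J : Frac R F) :
    MulQuot.mk (PicIn R F) (MulQuot.mk (Princ R F) I) =
        MulQuot.mk (PicIn R F) (MulQuot.mk (Princ R F) J) ↔
      ∃ A ∈ InvFrac R F, ∃ B ∈ InvFrac R F, I * A = J * B := by
  constructor
  · intro h
    obtain ⟨_, ⟨A, hA, rfl⟩, _, ⟨B, hB, rfl⟩, h⟩ := (Con.eq _).1 h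
    rw [← map_mul, ← map_mul] at h
    obtain ⟨x, hx, y, hy, h⟩ := (Con.eq _).1 h
    refine ⟨A * x, mul_mem hA (princ_le_invFrac R F hx), B * y,
      mul_mem hB (princ_le_invFrac R F hy), ?_⟩
    rw [← mul_assoc, ← mul_assoc, h]
  · rintro ⟨A, hA, B, hB, h⟩
    refine (Con.eq _).2 ⟨_, ⟨A, hA, rfl⟩, _, ⟨B, hB, rfl⟩, ?_⟩
    rw [← map_mul, ← map_mul, h]

omit hpL in
theorem mem_reg_cl_iff {R F : Type*} [CommRing R] [IsDomain R] [Field F] [Algebra R F]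
    [IsFractionRing R F] (I : Frac R F) :
    MulQuot.mk (Princ R F) I ∈ Reg (Cl R F) ↔ I ∈ Reg (Frac R F) := by
  constructor
  · rintro ⟨c, hc⟩
    obtain ⟨J, rfl⟩ := Con.mk'_surjective c
    rw [← map_mul, ← map_mul] at hc
    obtain ⟨x, hx, y, hy, h⟩ := (Con.eq _).1 hc
    obtain ⟨x', hx'⟩ := isUnit_iff_exists_inv.1 (princ_le_invFrac R F hx)
    refine ⟨J * y * x', ?_⟩
    calc I = I * x * x' := by rw [mul_assoc, hx', mul_one]
      _ = I * J * I * y * x' := by rw [h]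
      _ = I * (J * y * x') * I := by ac_rfl
  · rintro ⟨J, hJ⟩
    exact ⟨MulQuot.mk _ J, by rw [← map_mul, ← map_mul, ← hJ]⟩

variable (K) in
/-- The homomorphism `Cl / Pic → ⨁ M_p`. -/
def clModPicHom : ClModPic (IntCl o L) L →*
    Multiplicative (⨁ p : MaximalSpectrum o, LocalM K (pL p)) :=
  haveI := isFractionRing_intCl o K L
  (mulQuotCon (PicIn (IntCl o L) L)).lift
    ((mulQuotCon (Princ (IntCl o L) L)).lift (classFamilyHom K hpL) (by
      rintro I J ⟨x, hx, y, hy, h⟩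
      exact congrArg Multiplicative.ofAdd ((classFamily_eq_iff hpL I J).2
        ⟨x, princ_le_invFrac _ _ hx, y, princ_le_invFrac _ _ hy, h⟩))) (by
    intro c d hcd
    obtain ⟨I, rfl⟩ := Con.mk'_surjective c
    obtain ⟨J, rfl⟩ := Con.mk'_surjective d
    exact congrArg Multiplicative.ofAdd ((classFamily_eq_iff hpL I J).2
      ((mk_mk_eq_iff I J).1 ((Con.eq _).2 hcd))))

theorem clModPicHom_bijective : Function.Bijective (clModPicHom K hpL) := by
  have := isFractionRing_intCl o K L
  constructor
  · intro c d h
    obtain ⟨c, rfl⟩ := Con.mk'_surjective c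
    obtain ⟨d, rfl⟩ := Con.mk'_surjective d
    obtain ⟨I, rfl⟩ := Con.mk'_surjective c
    obtain ⟨J, rfl⟩ := Con.mk'_surjective d
    exact (mk_mk_eq_iff I J).2 ((classFamily_eq_iff hpL I J).1 (Multiplicative.ofAdd.injective h))
  · intro y
    obtain ⟨I, hI, -⟩ := exists_classFamily_eq (K := K) hpL (fun _ => ⊤) y.toAdd fun p => by
      obtain ⟨g, hg⟩ := AddCon.mk'_surjective (y.toAdd p)
      exact ⟨g, trivial, hg⟩
    exact ⟨MulQuot.mk _ (MulQuot.mk _ I), congrArg Multiplicative.ofAdd hI⟩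

variable (K) in
/-- The isomorphism `Cl / Pic ≃ ⨁ M_p`. -/
def clModPicEquiv : Additive (ClModPic (IntCl o L) L) ≃+
    ⨁ p : MaximalSpectrum o, LocalM K (pL p) :=
  AddEquiv.ofBijective (MonoidHom.toAdditiveLeft (clModPicHom K hpL)) (clModPicHom_bijective hpL)

end Isomorphism

end

end IdealClassMonoid

theorem corollary2p11 {o K L : Type*} [CommRing o] [IsDedekindDomain o] [Fact (¬ IsField o)]
    [Field K] [Algebra o K] [IsFractionRing o K] [Field L] [Algebra K L] [Algebra o L]
    [IsScalarTower o K L] [IsGalois K L]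
    (pL : MaximalSpectrum o → MaximalSpectrum (IntCl o L))
    (hpL : ∀ p, (pL p).asIdeal.LiesOver p.asIdeal) :
    ∃ e : Additive (ClModPic (IntCl o L) L) ≃+
        ⨁ p : MaximalSpectrum o, LocalM K (pL p),
      -- the class of `I` goes to the classes of the functions `σ D ↦ f̃_I(σ(pL p))`
      (∀ (I : Frac (IntCl o L) L) (p : MaximalSpectrum o),
        ∃ f : Sb (DecompQuot K (pL p))
            (vTilde K (pL p)),
          (∀ σ : Gal(L/K), f.1 (QuotientGroup.mk σ) = fTilde K I (σ • pL p)) ∧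
          e (Additive.ofMul (MulQuot.mk _ (MulQuot.mk _ I))) p =
            AddQuot.mk _ f) ∧
      -- equivariance
      (∀ (σ : Gal(L/K)) (c : ClModPic (IntCl o L) L)
        (p : MaximalSpectrum o),
        e (Additive.ofMul (σ • c)) p = σ • e (Additive.ofMul c) p) ∧
      -- the image of the regular part
      (fun c => e (Additive.ofMul (MulQuot.mk _ c))) ''
          Reg (Cl (IntCl o L) L) =
        {y | ∀ p, y p ∈ LocalN K (pL p)} ∧
      -- only the primes with non-discrete value group contribute
      {y : ⨁ p : MaximalSpectrum o, LocalM K (pL p) |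
          ∀ p, y p ∈ LocalN K (pL p)} =
        {y | (∀ p, y p ∈ LocalN K (pL p)) ∧
          ∀ p, p ∉ RInf K pL → y p = 0} := by
  have := isFractionRing_intCl o K L
  refine ⟨clModPicEquiv K hpL, fun I p => ⟨fibreFun K I (pL p), fun σ => rfl, rfl⟩, ?_, ?_, ?_⟩
  · intro σ c p
    obtain ⟨c, rfl⟩ := Con.mk'_surjective c
    obtain ⟨I, rfl⟩ := Con.mk'_surjective c
    change AddQuot.mk _ (fibreFun K (σ • I) (pL p)) = AddQuot.mk _ (σ • fibreFun K I (pL p))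
    rw [fibreFun_smul]
  · ext y
    constructor
    · rintro ⟨c, hc, rfl⟩ p
      obtain ⟨I, rfl⟩ := Con.mk'_surjective c
      exact ⟨fibreFun K I (pL p),
        (mem_reg_frac_iff hpL I).1 ((mem_reg_cl_iff I).1 hc) p, rfl⟩
    · intro hy
      obtain ⟨I, hI, hreg⟩ := exists_classFamily_eq hpL _ y hy
      exact ⟨MulQuot.mk _ I, (mem_reg_cl_iff I).2 ((mem_reg_frac_iff hpL I).2 hreg), hI⟩
  · ext y
    refine ⟨fun hy => ⟨hy, fun p hp => ?_⟩, fun hy => hy.1⟩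
    obtain ⟨f, hf, hfy⟩ := hy p
    have hV : vTilde K (pL p) = valSub K (pL p) := vTilde_eq_valSub (not_not.1 hp)
    rw [← hfy]
    have hf' : f ∈ SrefIn (DecompQuot K (pL p)) (vTilde K (pL p)) (valSub K (pL p)) := by
      have : SrefIn (DecompQuot K (pL p)) (vTilde K (pL p)) (vTilde K (pL p)) =
          SrefIn (DecompQuot K (pL p)) (vTilde K (pL p)) (valSub K (pL p)) :=
        congrArg (SrefIn _ _) hV
      exact this ▸ hf
    exact (AddCon.eq _).2 ⟨0, zero_mem _, f, hf', by rw [add_zero, zero_add]⟩
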